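/- Let $n\ge 0$ and $k\ge 1$ be integers and $[n]=\{1,\dots,n\}$. For a family $S\subseteq\binom{[n]}{k}$ let $\Delta(S)\subseteq\binom{[n]}{k-1}$ be its lower shadow, and $\Delta^i$ the $i$-fold iterated shadow. The $k$-binomial decomposition of $m\ge 1$ is the unique expression $m=\binom{a_0}{k}+\binom{a_1}{k-1}+\cdots+\binom{a_t}{k-t}$ with $a_0>a_1>\cdots>a_t\ge k-t\ge 1$ (for $m=0$ it is the empty sum); its coefficient $a_{k-1}$ exists iff $t=k-1$. The family $S$ is extremal if equality holds in the Kruskal–Katona bound, i.e. $|\Delta(S)|=\binom{a_0}{k-1}+\cdots+\binom{a_t}{k-t-1}$, where $(a_0,\dots,a_t)$ is the $k$-binomial decomposition of $|S|$ (so the empty family is extremal). A family is called a colex segment if, up to a permutation of $[n]$, it is an initial segment (possibly empty) of the colexicographic order on the subsets of $[n]$ of the given size. The hypergraph $H(S)$ of $S\subseteq\binom{[n]}{k}$ has vertex set $[n]$, and its edges are the inclusion-minimal sets among the sets $e\subseteq[n]$ with $1\le|e|\le k$ and $e\notin\Delta^{k-|e|}(S)$. Let $S\subseteq\binom{[n]}{k}$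 be extremal and let $P=\bigcup_{x\in S}x$ be its support. (A) Let $s\in\binom{P}{k}\setminus S$, and let $e$ be an edge of $H(S)$ with $e\subseteq s$. If $|e|=k$, then $e$ is the unique edge of $H(S)$ contained in $s$, and $S\cup\{s\}$ is extremal. If $|e|<k$, then $S\cup\{s\}$ is extremal if and only if all of the following hold: $S$ and $S\cup\{s\}$ are both colex segments; $e$ has maximal size among the edges of $H(S)$ (in particular $H(S)$ has no edge of size $k$); and $e$ is the unique edge of $H(S)$ contained in $s$. (B) Moreover: 1. If $S\ne\binom{[n]}{k}$, then $S$ is maximal (that is, $S\cup\{s\}$ is not extremal for every $s\in\binom{[n]}{k}\setminus S$) if and only if $H(S)$ has no edge of size $k$ and $S$ is not a colex segment. 2. If $S\neq\emptyset$, then $S$ is minimal (that is, $S\setminus\{s\}$ is not extremal for every $s\in S$) if and only if $a_{k-1}$ exists in the $k$-binomial decomposition of $|S|$, $a_{k-1}=1$, and there is no $s\in S$ such that $S\setminus\{s\}$ is a colex segment. 3. There is an enumeration $s_1,\dots,s_m$ of all the elements of $\binom{[n]}{k}\setminus S$ such that $S\cup\{s_1,\dots,s_i\}$ is extremal for all $i\in[m]$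 if and only if $\Delta(S)$ is a colex segment in $\binom{[n]}{k-1}$; equivalently, if and only if the hypergraph formed by the edges of $H(S)$ of size at most $k-1$ is the hypergraph of a colex segment in $\binom{[n]}{k-1}$. 4. Suppose that $a_{k-1}$ exists in the $k$-binomial decomposition of $|S|$. There is an enumeration $s_1,\dots,s_m$ of all the elements of $S$ such that $S\setminus\{s_1,\dots,s_i\}$ is extremal for all $i\in[m]$ if and only if $a_{k-1}\ge 1$ and $S$ is obtained from a colex segment by adding $a_{k-1}$ further $k$-sets. If $a_{k-1}$ does not exist, then such an enumeration always exists. -/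

import Mathlib

namespace ExtremalFamily

/-- `a 0 > a 1 > ⋯ > a (l-1)` is the `k`-binomial decomposition of `m`:
`l ≤ k`, `a i ≥ k - i` (by strict monotonicity it amounts to require this for the last index) and
`m = ∑ i, (a i).choose (k - i)`.
For `m = 0` it is the empty sequence. Since `i < l ≤ k`, the subtraction `k - i` is never
truncated. -/
structure IsBinomialDecomp (k m l : ℕ) (a : Fin l → ℕ) : Prop where
  length_le : l ≤ k
  strictAnti : StrictAnti a
  le_coeff : ∀ i : Fin l, k - (i : ℕ) ≤ a i
  sum_eq : m = ∑ i : Fin l, (a i).choose (k - (i : ℕ))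

/-- The `k`-binomial decomposition of `m` has full length `k`, so that its coefficient `a_{k-1}`
exists, and `a_{k-1} = c`. -/
def HasLastCoeff (k m c : ℕ) : Prop :=
  ∃ a : Fin k → ℕ, IsBinomialDecomp k m k a ∧ ∃ i : Fin k, (i : ℕ) + 1 = k ∧ a i = c

/-- `S` is a family of `k`-subsets of an `n`-element set whose shadow has exactly the size given
by the Kruskal-Katona lower bound. -/
def IsExtremal {n : ℕ} (k : ℕ) (S : Finset (Finset (Fin n))) : Prop :=
  S ⊆ Finset.powersetCard k Finset.univ ∧
    ∃ (l : ℕ) (a : Fin l → ℕ), IsBinomialDecomp k S.card l a ∧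
      (Finset.shadow S).card = ∑ i : Fin l, (a i).choose (k - (i : ℕ) - 1)

/-- `S` is, up to a permutation of the ground set, an initial segment of the colexicographic order
on `k`-subsets. -/
def IsColexSegment {n : ℕ} (k : ℕ) (S : Finset (Finset (Fin n))) : Prop :=
  ∃ σ : Equiv.Perm (Fin n), Finset.Colex.IsInitSeg (S.image (fun s => s.image σ)) k

/-- `e` has between `1` and `k` elements and is not in the iterated shadow of `S` of its level. -/
def IsMissing {n : ℕ} (k : ℕ) (S : Finset (Finset (Fin n))) (e : Finset (Fin n)) : Prop :=
  1 ≤ e.card ∧ e.card ≤ k ∧ e ∉ Finset.shadow^[k - e.card] S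

/-- The edge set of the hypergraph `H(S)` of a family `S` of `k`-sets: the inclusion-minimal
missing sets. -/
def hyperedges {n : ℕ} (k : ℕ) (S : Finset (Finset (Fin n))) : Set (Finset (Fin n)) :=
  {e | Minimal (IsMissing k S) e}

/-- The support of a family: the union of its members. -/
def support {n : ℕ} (S : Finset (Finset (Fin n))) : Finset (Fin n) :=
  S.biUnion id

/-- The `k`-sets not in `S` can be enumerated as `s_1, …, s_m` in such a way that
`S ∪ {s_1, …, s_i}` is extremal for every `1 ≤ i ≤ m`. -/
def HasAddingChain {n : ℕ} (k : ℕ) (S : Finset (Finset (Fin n))) : Prop :=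
  ∃ L : List (Finset (Fin n)), L.Nodup ∧
    L.toFinset = Finset.powersetCard k Finset.univ \ S ∧
    ∀ i : ℕ, 1 ≤ i → i ≤ L.length → IsExtremal k (S ∪ (L.take i).toFinset)

/-- The members of `S` can be enumerated as `s_1, …, s_m` in such a way that
`S \ {s_1, …, s_i}` is extremal for every `1 ≤ i ≤ m`. -/
def HasRemovingChain {n : ℕ} (k : ℕ) (S : Finset (Finset (Fin n))) : Prop :=
  ∃ L : List (Finset (Fin n)), L.Nodup ∧ L.toFinset = S ∧
    ∀ i : ℕ, 1 ≤ i → i ≤ L.length → IsExtremal k (S \ (L.take i).toFinset)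

end ExtremalFamily

open ExtremalFamily

/-!
`kk k m` is the Kruskal-Katona bound `∑ i, (a i).choose (k - i - 1)` and `len k m` the number of
terms of the `k`-binomial decomposition of `m`. Their relation is `kk_succ`:
`kk k (m + 1) = kk k m + (k - len k m)`. So enlarging a family by one set keeps the bound if the
decomposition of its size has full length `k`, and raises the bound if it has not.

The heart of the proof is that an extremal family whose decomposition has fewer than `k` terms is
a colex segment (`isColexSegment_of_len_le`). If the family is shifted, comparing the link and the
deletion of the first vertex with the sizes `maxDeg k m` and `m - maxDeg k m` that they have in a
segment shows that the family contains all `k`-subsets of a set `A` with `lead k m` elements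
(`exists_clique_of_shifted`); this only needs a shadow smaller than `kk k (m + 1)`, a hypothesis
that passes to the deletion. Strict subadditivity of `kk` (`kk_add_lt`) then forces the remaining
sets to share one vertex `v` outside of `A`, so that the family is a cone over an extremal family of
smaller uniformity (`eq_cone_of_clique`), and induction applies. A family that is not shifted is
turned into a shifted one step by step. The clique survives when such a step is undone
(`exists_clique_of_shift`): the link of the vertex that is exchanged is a segment by induction, and
the non-members of a segment are connected through facets outside of its shadow
(`connected_compl`), so that the step moves either all of the relevant sets or none of them.

When the length is `k`, the last coefficient `c` counts the sets that have to be removed to lower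
the length: the bound drops by one with the last of them and not before (`HasLastCoeff.pred`,
`HasLastCoeff.len_sub`). Adding a set `s` to an extremal family such that the result is extremal is
of one of two kinds. Either all facets of `s` lie in the shadow, so that `s` is an edge of `H(S)` of
size `k`; this always preserves extremality. Or the shadow grows, the old length is less than `k`,
and both families are segments (`isColexSegment_of_insert`). The statements on maximal and minimal
families and on chains follow from this by counting. For the edges of `H(S)` inside `s`, the
iterated shadows of a segment `S` with decomposition of length `l < k` are segments with
decompositions of the same length down to uniformity `l`, so that all edges have at most `l`
elements (`IsColexSegment.card_hyperedge_le`), whereas at least `k - #e` facets of `s` are new and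
only `k - l` of them are allowed.
-/

namespace ExtremalFamily
open Finset Finset.Colex
open scoped FinsetFamily

/-! ### The Kruskal-Katona function -/

/-- The leading coefficient of the `k`-binomial decomposition of `m`: the largest `a` with
`a.choose k ≤ m` (the search bound `m + k` is large enough when `1 ≤ k`). -/
def lead (k m : ℕ) : ℕ := Nat.findGreatest (fun a => a.choose k ≤ m) (m + k)

/-- The Kruskal-Katona lower bound for the shadow of `m` sets of size `k`, computed greedily. -/
def kk : ℕ → ℕ → ℕ
  | 0, _ => 0
  | k + 1, m => if m = 0 then 0 else
      (lead (k + 1) m).choose k + kk k (m - (lead (k + 1) m).choose (k + 1))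

/-- The number of terms of the `k`-binomial decomposition of `m`. -/
def len : ℕ → ℕ → ℕ
  | 0, _ => 0
  | k + 1, m => if m = 0 then 0 else
      1 + len k (m - (lead (k + 1) m).choose (k + 1))

/-- For `m = ∑ i, (a i).choose (k - i)` the number `∑ i, (a i - 1).choose (k - 1 - i)`, which is the
largest degree in an extremal family of `m` sets of size `k`. -/
def maxDeg : ℕ → ℕ → ℕ
  | 0, _ => 0
  | k + 1, m => if m = 0 then 0 else
      (lead (k + 1) m - 1).choose k + maxDeg k (m - (lead (k + 1) m).choose (k + 1))

theorem le_choose_add (a k : ℕ) : a ≤ a.choose (k + 1) + k := by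
  induction a with
  | zero => simp
  | succ a ih =>
    rw [Nat.choose_succ_succ']
    rcases Nat.lt_or_ge a k with h | h
    · omega
    · have := Nat.choose_pos h
      omega

theorem lead_eq {k m a : ℕ} (h1 : a.choose (k + 1) ≤ m) (h2 : m < (a + 1).choose (k + 1)) :
    lead (k + 1) m = a := by
  rw [lead, Nat.findGreatest_eq_iff]
  refine ⟨by have := le_choose_add a k; omega, fun _ => h1, fun b hb _ => ?_⟩
  have := Nat.choose_le_choose (k + 1) (Nat.succ_le_of_lt hb)
  simp only [Nat.succ_eq_add_one] at this
  omega

theorem lead_add {k a x : ℕ} (hx : x < a.choose k) :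
    lead (k + 1) (a.choose (k + 1) + x) = a :=
  lead_eq (Nat.le_add_right _ _) (by rw [Nat.choose_succ_succ']; omega)

theorem exists_cascade {k m : ℕ} (hm : m ≠ 0) :
    ∃ a x, k + 1 ≤ a ∧ x < a.choose k ∧ m = a.choose (k + 1) + x := by
  set a := lead (k + 1) m with ha
  have h1 : a.choose (k + 1) ≤ m :=
    Nat.findGreatest_spec (P := fun a => a.choose (k + 1) ≤ m) (m := 0) (Nat.zero_le _) (by simp)
  have h2 : m < (a + 1).choose (k + 1) := by
    by_contra! h
    have h3 := le_choose_add (a + 1) k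
    have := Nat.le_findGreatest (P := fun a => a.choose (k + 1) ≤ m) (n := m + (k + 1))
      (by omega : a + 1 ≤ _) h
    have h4 : Nat.findGreatest (fun a => a.choose (k + 1) ≤ m) (m + (k + 1)) = a := rfl
    omega
  have h5 : k + 1 ≤ a := by
    by_contra! h
    have : (a + 1).choose (k + 1) ≤ (k + 1).choose (k + 1) := Nat.choose_le_choose _ h
    rw [Nat.choose_self] at this
    omega
  exact ⟨a, m - a.choose (k + 1), h5, by rw [Nat.choose_succ_succ'] at h2; omega, by omega⟩

/-- Induction along binomial decompositions. -/
theorem cascade_induction {P : ℕ → ℕ → Prop} (zero : ∀ k, P k 0)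
    (step : ∀ k a x, k + 1 ≤ a → x < a.choose k → P k x → P (k + 1) (a.choose (k + 1) + x)) :
    ∀ k m, (k = 0 → m = 0) → P k m := by
  intro k
  induction k with
  | zero => intro m hm; rw [hm rfl]; exact zero 0
  | succ k ih =>
    intro m _
    rcases eq_or_ne m 0 with rfl | hm
    · exact zero _
    obtain ⟨a, x, ha, hx, rfl⟩ := exists_cascade (k := k) hm
    refine step k a x ha hx (ih x ?_)
    rintro rfl
    simpa using hx

@[simp] theorem kk_zero (k : ℕ) : kk k 0 = 0 := by cases k <;> simp [kk]
@[simp] theorem kk_zero_left (m : ℕ) : kk 0 m = 0 := rfl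
@[simp] theorem len_zero (k : ℕ) : len k 0 = 0 := by cases k <;> simp [len]
@[simp] theorem maxDeg_zero (k : ℕ) : maxDeg k 0 = 0 := by cases k <;> simp [maxDeg]

section
variable {k a x : ℕ}

theorem kk_cascade (ha : k + 1 ≤ a) (hx : x < a.choose k) :
    kk (k + 1) (a.choose (k + 1) + x) = a.choose k + kk k x := by
  have := Nat.choose_pos ha
  rw [kk, lead_add hx, if_neg (by omega), Nat.add_sub_cancel_left]

theorem len_cascade (ha : k + 1 ≤ a) (hx : x < a.choose k) :
    len (k + 1) (a.choose (k + 1) + x) = 1 + len k x := by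
  have := Nat.choose_pos ha
  rw [len, lead_add hx, if_neg (by omega), Nat.add_sub_cancel_left]

theorem maxDeg_cascade (ha : k + 1 ≤ a) (hx : x < a.choose k) :
    maxDeg (k + 1) (a.choose (k + 1) + x) = (a - 1).choose k + maxDeg k x := by
  have := Nat.choose_pos ha
  rw [maxDeg, lead_add hx, if_neg (by omega), Nat.add_sub_cancel_left]

end

theorem kk_choose {k a : ℕ} (ha : k + 1 ≤ a) : kk (k + 1) (a.choose (k + 1)) = a.choose k := by
  simpa using kk_cascade ha (x := 0) (Nat.choose_pos (by omega))

theorem kk_one (k : ℕ) : kk k 1 = k := by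
  cases k with
  | zero => rfl
  | succ k => simpa using kk_choose (le_refl (k + 1))

/-- The recursion for `kk` without the greedy choice of the first term. -/
theorem kk_rec {k a x : ℕ} (ha : k ≤ a) (hx : 1 ≤ x) (hx' : x ≤ a.choose k) :
    kk (k + 1) (a.choose (k + 1) + x) = a.choose k + kk k x := by
  rcases ha.eq_or_lt with rfl | ha
  · rw [Nat.choose_self] at hx' ⊢
    obtain rfl : x = 1 := by omega
    rw [Nat.choose_succ_self, Nat.zero_add, kk_one, kk_one]
    omega
  rcases hx'.eq_or_lt with rfl | hx'
  · rw [Nat.add_comm (a.choose (k + 1)), ← Nat.choose_succ_succ', kk_choose (by omega)]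
    cases k with
    | zero => simp
    | succ k => rw [kk_choose (by omega), Nat.choose_succ_succ' a k]; omega
  · exact kk_cascade ha hx'

theorem len_le : ∀ k m : ℕ, len k m ≤ k
  | 0, _ => le_rfl
  | k + 1, m => by
    rw [len]
    split_ifs
    · omega
    · have := len_le k (m - (lead (k + 1) m).choose (k + 1))
      omega

/-- The growth of the Kruskal-Katona function is governed by the length of the decomposition. -/
theorem kk_succ {k m : ℕ} (h : k = 0 → m = 0) : kk k (m + 1) + len k m = kk k m + k := by
  refine cascade_induction (P := fun k m => kk k (m + 1) + len k m = kk k m + k) ?_ ?_ k m h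
  · intro k; simp [kk_one]
  · intro k a x ha hx ih
    rw [Nat.add_assoc, kk_rec (x := x + 1) (by omega) (by omega) hx, len_cascade ha hx,
      kk_cascade ha hx]
    omega

theorem kk_le_succ (k m : ℕ) : kk k m ≤ kk k (m + 1) := by
  cases k with
  | zero => simp
  | succ k =>
    have := kk_succ (k := k + 1) (m := m) (by simp)
    have := len_le (k + 1) m
    omega

theorem kk_mono (k : ℕ) : Monotone (kk k) := monotone_nat_of_le_succ (kk_le_succ k)

theorem len_pos {k m : ℕ} (hm : m ≠ 0) : 1 ≤ len (k + 1) m := by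
  rw [len, if_neg hm]; omega

/-- Removing the star of size `maxDeg k x` lowers the leading coefficient. -/
theorem sub_maxDeg_lt : ∀ {k a x : ℕ}, (k = 0 → x = 0) → k ≤ a → x < (a + 1).choose k →
    x - maxDeg k x < a.choose k := by
  intro k a x h
  refine cascade_induction (P := fun k x => ∀ a, k ≤ a → x < (a + 1).choose k →
    x - maxDeg k x < a.choose k) ?_ ?_ k x h a
  · intro k a ha _; simpa using Nat.choose_pos ha
  · intro k b y hb hy ih a _ h
    have hba : b ≤ a := by
      by_contra! hab
      have := Nat.choose_le_choose (k + 1) (Nat.succ_le_of_lt hab)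
      simp only [Nat.succ_eq_add_one] at this
      omega
    obtain ⟨b, rfl⟩ : ∃ c, b = c + 1 := ⟨b - 1, by omega⟩
    have h1 := ih b (by omega) hy
    rw [maxDeg_cascade hb hy, Nat.add_sub_cancel]
    have h2 := Nat.choose_succ_succ' b k
    have h3 := Nat.choose_le_choose (k + 1) hba
    have h4 := Nat.choose_succ_succ' b k
    rw [h4] at h3
    omega

theorem maxDeg_le {k m : ℕ} (h : k = 0 → m = 0) : maxDeg k m ≤ m := by
  refine cascade_induction (P := fun k m => maxDeg k m ≤ m) ?_ ?_ k m h
  · simp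
  · intro k a x ha hx ih
    rw [maxDeg_cascade ha hx]
    obtain ⟨b, rfl⟩ : ∃ c, a = c + 1 := ⟨a - 1, by omega⟩
    rw [Nat.add_sub_cancel, Nat.choose_succ_succ' b k]
    omega

/-- A vertex of a family that does not exceed the complete one on `a + 1` points has less than the full
degree if the decomposition of the size is short. -/
theorem maxDeg_lt : ∀ {k a x : ℕ}, len (k + 1) x ≤ k → k ≤ a → x < (a + 1).choose (k + 1) →
    maxDeg (k + 1) x < a.choose k := by
  intro k
  induction k with
  | zero =>
    intro a x h _ _
    rcases eq_or_ne x 0 with rfl | hx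
    · simp
    · have := len_pos (k := 0) hx
      omega
  | succ k ih =>
    intro a x h ha hx
    rcases eq_or_ne x 0 with rfl | hx0
    · simpa using Nat.choose_pos ha
    obtain ⟨b, y, hb, hy, rfl⟩ := exists_cascade (k := k + 1) hx0
    rw [len_cascade hb hy] at h
    rw [maxDeg_cascade hb hy]
    have hba : b ≤ a := by
      by_contra! hab
      have := Nat.choose_le_choose (k + 1 + 1) (Nat.succ_le_of_lt hab)
      simp only [Nat.succ_eq_add_one] at this
      omega
    obtain ⟨b, rfl⟩ : ∃ c, b = c + 1 := ⟨b - 1, by omega⟩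
    have h1 := ih (a := b) (x := y) (by omega) (by omega) hy
    have h3 := Nat.choose_le_choose (k + 1) hba
    rw [Nat.choose_succ_succ' b k] at h3
    rw [Nat.add_sub_cancel]
    omega

theorem kk_lt : ∀ {k a x : ℕ}, len (k + 1) x ≤ k → k ≤ a → x < a.choose (k + 1) →
    kk (k + 1) x < a.choose k := by
  intro k
  induction k with
  | zero =>
    intro a x h _ _
    rcases eq_or_ne x 0 with rfl | hx
    · simp
    · have := len_pos (k := 0) hx
      omega
  | succ k ih =>
    intro a x h ha hx
    rcases eq_or_ne x 0 with rfl | hx0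
    · simpa using Nat.choose_pos ha
    obtain ⟨b, y, hb, hy, rfl⟩ := exists_cascade (k := k + 1) hx0
    rw [len_cascade hb hy] at h
    rw [kk_cascade hb hy]
    have hba : b + 1 ≤ a := by
      by_contra! hab
      have := Nat.choose_le_choose (k + 1 + 1) (Nat.le_of_lt_succ hab)
      omega
    have h1 := ih (a := b) (x := y) (by omega) (by omega) hy
    have h3 := Nat.choose_le_choose (k + 1) hba
    rw [Nat.choose_succ_succ' b k] at h3
    omega

/-- A vertex of degree larger than `maxDeg` forces a shadow of more than the minimum size. -/
theorem kk_succ_le_maxDeg {k : ℕ} : ∀ {m : ℕ}, len (k + 1) m ≤ k →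
    kk (k + 1) (m + 1) ≤ maxDeg (k + 1) m + 1 + kk k (maxDeg (k + 1) m + 1) := by
  induction k with
  | zero =>
    intro m h
    rcases eq_or_ne m 0 with rfl | hm
    · simp [kk_one]
    · have := len_pos (k := 0) hm
      omega
  | succ k ih =>
    intro m h
    rcases eq_or_ne m 0 with rfl | hm
    · simp only [Nat.zero_add, kk_one, maxDeg_zero]; omega
    obtain ⟨a, x, ha, hx, rfl⟩ := exists_cascade (k := k + 1) hm
    rw [len_cascade ha hx] at h
    have h1 := ih (m := x) (by omega)
    obtain ⟨b, rfl⟩ : ∃ c, a = c + 1 := ⟨a - 1, by omega⟩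
    have h2 := maxDeg_lt (a := b) (by omega) (by omega) hx
    rw [Nat.add_assoc (_ : ℕ) x, kk_rec (x := x + 1) (by omega) (by omega) hx,
      maxDeg_cascade ha hx, Nat.add_sub_cancel, Nat.add_assoc (b.choose (k + 1)),
      kk_rec (x := maxDeg (k + 1) x + 1) (by omega) (by omega) h2, Nat.choose_succ_succ' b k]
    omega

/-- If a vertex had degree less than `maxDeg`, the other sets would have too large a shadow. -/
theorem maxDeg_lt_kk {k : ℕ} : ∀ {m : ℕ}, len (k + 1) m ≤ k →
    maxDeg (k + 1) m < kk (k + 1) (m - maxDeg (k + 1) m + 1) := by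
  induction k with
  | zero =>
    intro m h
    rcases eq_or_ne m 0 with rfl | hm
    · simp [kk_one]
    · have := len_pos (k := 0) hm
      omega
  | succ k ih =>
    intro m h
    rcases eq_or_ne m 0 with rfl | hm
    · simp [kk_one]
    obtain ⟨a, x, ha, hx, rfl⟩ := exists_cascade (k := k + 1) hm
    rw [len_cascade ha hx] at h
    obtain ⟨b, rfl⟩ : ∃ c, a = c + 1 := ⟨a - 1, by omega⟩
    have h1 := sub_maxDeg_lt (k := k + 1) (by simp) (by omega : k + 1 ≤ b) hx
    have h2 := maxDeg_le (k := k + 1) (m := x) (by simp)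
    rw [maxDeg_cascade ha hx, Nat.add_sub_cancel, Nat.choose_succ_succ' b (k + 1)]
    have h3 : b.choose (k + 1) + b.choose (k + 1 + 1) + x -
        (b.choose (k + 1) + maxDeg (k + 1) x) + 1 =
        b.choose (k + 1 + 1) + (x - maxDeg (k + 1) x + 1) := by
      omega
    rw [h3, kk_rec (x := x - maxDeg (k + 1) x + 1) (by omega) (by omega) h1]
    have := ih (m := x) (by omega)
    omega

/-- The shadow of an extremal family has a decomposition of the same length, if that is possible. -/
theorem len_kk {k : ℕ} : ∀ {m : ℕ}, len (k + 1) m ≤ k → len k (kk (k + 1) m) = len (k + 1) m := by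
  induction k with
  | zero => intro m h; simp only [len] at h ⊢; omega
  | succ k ih =>
    intro m h
    rcases eq_or_ne m 0 with rfl | hm
    · simp
    obtain ⟨a, x, ha, hx, rfl⟩ := exists_cascade (k := k + 1) hm
    rw [len_cascade ha hx] at h ⊢
    have h1 := kk_lt (by omega) (by omega : k ≤ a) hx
    rw [kk_cascade ha hx, len_cascade (by omega) h1, ih (by omega)]

/-! ### Segments with respect to a ranking of the ground set -/

/-- `S` is a family of `k`-sets closed downwards in the colexicographic order, where the ground set
is ordered by `r`. For injective `r`, this is an initial segment up to a permutation. -/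
def IsRankSeg {α : Type*} [DecidableEq α] (r : α → ℕ) (k : ℕ) (S : Finset (Finset α)) : Prop :=
  (S : Set (Finset α)).Sized k ∧
    ∀ s ∈ S, ∀ t : Finset α, t.card = k → toColex (t.image r) ≤ toColex (s.image r) → t ∈ S

theorem shadow_image {α β : Type*} [DecidableEq α] [DecidableEq β] {f : α → β}
    (hf : Function.Injective f) (S : Finset (Finset α)) :
    ∂ (S.image (image f)) = (∂ S).image (image f) := by
  ext t
  simp only [mem_shadow_iff, mem_image]
  constructor
  · rintro ⟨_, ⟨s, hs, rfl⟩, _, hb, rfl⟩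
    obtain ⟨a, ha, rfl⟩ := mem_image.1 hb
    exact ⟨s.erase a, ⟨s, hs, a, ha, rfl⟩, image_erase hf s a⟩
  · rintro ⟨_, ⟨s, hs, a, ha, rfl⟩, rfl⟩
    exact ⟨_, ⟨s, hs, rfl⟩, f a, mem_image_of_mem f ha, (image_erase hf s a).symm⟩

section Rank
variable {n : ℕ} {r : Fin n → ℕ} {k : ℕ} {S : Finset (Finset (Fin n))}

/-- A ranking is a permutation followed by a strictly monotone map. -/
theorem exists_perm_strictMono (hr : Function.Injective r) :
    ∃ (σ : Equiv.Perm (Fin n)) (f : Fin n → ℕ), StrictMono f ∧ r = f ∘ σ := by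
  refine ⟨(Tuple.sort r).symm, r ∘ Tuple.sort r, ?_, by ext; simp⟩
  exact (Tuple.monotone_sort r).strictMono_of_injective (hr.comp (Equiv.injective _))

theorem isRankSeg_comp_iff {σ : Equiv.Perm (Fin n)} {f : Fin n → ℕ} (hf : StrictMono f) :
    IsRankSeg (f ∘ σ) k S ↔ IsInitSeg (S.image (fun s => s.image σ)) k := by
  have key : ∀ s t : Finset (Fin n), toColex (t.image (f ∘ σ)) ≤ toColex (s.image (f ∘ σ)) ↔
      toColex (t.image σ) ≤ toColex (s.image σ) := by
    intro s t
    rw [← image_image, ← image_image, toColex_image_le_toColex_image hf]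
  have hinj := Finset.image_injective σ.injective
  have hmem : ∀ s : Finset (Fin n), s.image σ ∈ S.image (fun s => s.image σ) ↔ s ∈ S :=
    fun s => hinj.mem_finset_image
  have hsurj : ∀ t : Finset (Fin n), ∃ s : Finset (Fin n), s.image σ = t := fun t =>
    ⟨t.image σ.symm, by simp [image_image]⟩
  constructor
  · rintro ⟨h1, h2⟩
    refine ⟨?_, ?_⟩
    · intro t ht
      obtain ⟨s, hs, rfl⟩ := mem_image.1 (mem_coe.1 ht)
      rw [card_image_of_injective _ σ.injective]
      exact h1 hs
    · intro s t hs ⟨hts, ht⟩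
      obtain ⟨s, rfl⟩ := hsurj s
      obtain ⟨t, rfl⟩ := hsurj t
      rw [card_image_of_injective _ σ.injective] at ht
      rw [hmem] at hs ⊢
      exact h2 s hs t ht ((key _ _).2 hts.le)
  · rintro ⟨h1, h2⟩
    refine ⟨?_, ?_⟩
    · intro s hs
      rw [← card_image_of_injective s σ.injective]
      exact h1 (mem_coe.2 ((hmem s).2 hs))
    · intro s hs t ht hts
      rw [← hmem] at hs ⊢
      rcases ((key _ _).1 hts).eq_or_lt with h | h
      · rwa [toColex_inj.1 h]
      · exact h2 hs ⟨h, by rwa [card_image_of_injective _ σ.injective]⟩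

theorem isColexSegment_iff :
    IsColexSegment k S ↔ ∃ r : Fin n → ℕ, Function.Injective r ∧ IsRankSeg r k S := by
  constructor
  · rintro ⟨σ, hσ⟩
    exact ⟨_, Fin.val_injective.comp σ.injective, (isRankSeg_comp_iff Fin.val_strictMono).2 hσ⟩
  · rintro ⟨r, hr, h⟩
    obtain ⟨σ, f, hf, rfl⟩ := exists_perm_strictMono hr
    exact ⟨σ, (isRankSeg_comp_iff hf).1 h⟩

theorem IsRankSeg.shadow (hr : Function.Injective r) (h : IsRankSeg r k S) :
    IsRankSeg r (k - 1) (∂ S) := by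
  obtain ⟨σ, f, hf, rfl⟩ := exists_perm_strictMono hr
  rw [isRankSeg_comp_iff hf] at h ⊢
  rw [← shadow_image σ.injective]
  exact h.shadow

theorem IsColexSegment.shadow (h : IsColexSegment k S) : IsColexSegment (k - 1) (∂ S) := by
  obtain ⟨r, hr, h⟩ := isColexSegment_iff.1 h
  exact isColexSegment_iff.2 ⟨r, hr, h.shadow hr⟩

theorem IsRankSeg.exists_erase (hr : Function.Injective r) (h : IsRankSeg r k S)
    (hS : S.Nonempty) : ∃ s ∈ S, IsRankSeg r k (S.erase s) := by
  obtain ⟨s, hs, hmax⟩ := S.exists_max_image (fun s => toColex (s.image r)) hS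
  refine ⟨s, hs, fun t ht => h.1 (mem_of_mem_erase ht), fun t ht u hu hut => ?_⟩
  have ht' := mem_of_mem_erase ht
  refine mem_erase.2 ⟨?_, h.2 t ht' u hu hut⟩
  rintro rfl
  have := le_antisymm (hmax t ht') hut
  rw [toColex_inj] at this
  exact (ne_of_mem_erase ht) (Finset.image_injective hr this)

theorem IsRankSeg.exists_insert (hr : Function.Injective r) (h : IsRankSeg r k S)
    (hS : S ≠ powersetCard k univ) : ∃ s ∈ powersetCard k univ, s ∉ S ∧
      IsRankSeg r k (insert s S) := by
  have hne : (powersetCard k univ \ S).Nonempty := by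
    rw [sdiff_nonempty]
    exact fun hh => hS ((subset_antisymm fun s hs => by simpa using h.1 hs) hh)
  obtain ⟨s, hs, hmin⟩ := exists_min_image _ (fun s => toColex (s.image r)) hne
  rw [mem_sdiff] at hs
  refine ⟨s, hs.1, hs.2, ?_, ?_⟩
  · intro t ht
    rcases mem_insert.1 (mem_coe.1 ht) with rfl | ht
    · simpa using hs.1
    · exact h.1 ht
  · intro t ht u hu hut
    by_contra huS
    rw [mem_insert, not_or] at huS
    have h1 := hmin u (by simp [hu, huS.2])
    rcases mem_insert.1 ht with rfl | ht
    · exact huS.1 (Finset.image_injective hr (toColex_inj.1 (le_antisymm hut h1)))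
    · exact huS.2 (h.2 t ht u hu hut)

theorem isRankSeg_powersetCard (r : Fin n → ℕ) (k c : ℕ) :
    IsRankSeg r k (powersetCard k {x | r x < c}) := by
  refine ⟨by simp [Set.Sized], fun s hs t ht hts => ?_⟩
  rw [mem_powersetCard] at hs ⊢
  refine ⟨fun x hx => ?_, ht⟩
  have := forall_lt_mono hts (a := c) (by
    intro b hb
    obtain ⟨y, hy, rfl⟩ := mem_image.1 hb
    simpa using hs.1 hy) (r x) (mem_image_of_mem r hx)
  simpa using this

theorem isRankSeg_powersetCard_univ (r : Fin n → ℕ) (k : ℕ) :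
    IsRankSeg r k (powersetCard k univ) :=
  ⟨by simp [Set.Sized], fun s hs t ht hts => by simpa using ht⟩

theorem IsRankSeg.exists_card (hr : Function.Injective r) (h : IsRankSeg r k S) {x : ℕ}
    (hx : x ≤ S.card) : ∃ T ⊆ S, T.card = x ∧ IsRankSeg r k T := by
  induction hx using Nat.decreasingInduction with
  | self => exact ⟨S, subset_rfl, rfl, h⟩
  | of_succ x hx ih =>
    obtain ⟨T, hTS, hT, hTr⟩ := ih
    obtain ⟨s, hs, hs'⟩ := hTr.exists_erase hr (card_pos.1 (by omega))
    exact ⟨_, (erase_subset _ _).trans hTS, by rw [card_erase_of_mem hs]; omega, hs'⟩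

end Rank

/-! ### Cones -/

section Cone
variable {α : Type*} [DecidableEq α]

/-- The complete family of `k`-sets on `A`, together with the cone with apex `v` over `T`. -/
def cone (k : ℕ) (A : Finset α) (v : α) (T : Finset (Finset α)) : Finset (Finset α) :=
  powersetCard k A ∪ T.image (insert v)

variable {k : ℕ} {A : Finset α} {v : α} {T : Finset (Finset α)}

theorem insert_injOn (v : α) : Set.InjOn (insert v) {s : Finset α | v ∉ s} := by
  intro s hs t ht h
  rw [← erase_insert hs, ← erase_insert ht, h]

theorem mem_cone_of_notMem {s : Finset α} (hs : v ∉ s) :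
    s ∈ cone k A v T ↔ s ∈ powersetCard k A := by
  simp only [cone, mem_union, mem_image, or_iff_left_iff_imp, forall_exists_index, and_imp]
  rintro t _ rfl
  simp at hs

theorem insert_mem_cone (hv : v ∉ A) (hT : T ⊆ powersetCard k A) {s : Finset α} (hs : v ∉ s) :
    insert v s ∈ cone (k + 1) A v T ↔ s ∈ T := by
  simp only [cone, mem_union, mem_image, mem_powersetCard]
  constructor
  · rintro (h | ⟨t, ht, h⟩)
    · exact absurd (h.1 (mem_insert_self _ _)) hv
    · have hvt : v ∉ t := fun h => hv ((mem_powersetCard.1 (hT ht)).1 h)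
      rwa [← insert_injOn v hvt hs h]
  · exact fun h => Or.inr ⟨s, h, rfl⟩

theorem card_image_insert (hv : ∀ t ∈ T, v ∉ t) : (T.image (insert v)).card = T.card :=
  card_image_of_injOn ((insert_injOn v).mono fun t ht => hv t ht)

theorem card_cone (hv : v ∉ A) (hT : T ⊆ powersetCard k A) :
    (cone (k + 1) A v T).card = A.card.choose (k + 1) + T.card := by
  rw [cone, card_union_of_disjoint, card_powersetCard, card_image_insert]
  · exact fun t ht h => hv ((mem_powersetCard.1 (hT ht)).1 h)
  · rw [disjoint_left]
    intro s hs hs'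
    obtain ⟨t, _, rfl⟩ := mem_image.1 hs'
    exact hv ((mem_powersetCard.1 hs).1 (mem_insert_self _ _))

theorem shadow_powersetCard_subset : ∂ (powersetCard (k + 1) A) ⊆ powersetCard k A := by
  intro t ht
  obtain ⟨s, hs, a, ha, rfl⟩ := mem_shadow_iff.1 ht
  rw [mem_powersetCard] at hs ⊢
  exact ⟨(erase_subset _ _).trans hs.1, by rw [card_erase_of_mem ha, hs.2]; rfl⟩

theorem shadow_powersetCard (h : k + 1 ≤ A.card) :
    ∂ (powersetCard (k + 1) A) = powersetCard k A := by
  refine subset_antisymm shadow_powersetCard_subset fun f hf => ?_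
  rw [mem_powersetCard] at hf
  obtain ⟨x, hx, hxf⟩ := exists_mem_notMem_of_card_lt_card (s := f) (t := A) (by omega)
  refine mem_shadow_iff_insert_mem.2 ⟨x, hxf, mem_powersetCard.2 ⟨insert_subset hx hf.1, ?_⟩⟩
  rw [card_insert_of_notMem hxf, hf.2]

theorem shadow_cone (hv : v ∉ A) (hT : T ⊆ powersetCard k A)
    (h : k + 1 ≤ A.card ∨ T.Nonempty) : ∂ (cone (k + 1) A v T) = cone k A v (∂ T) := by
  have hvT : ∀ t ∈ T, v ∉ t := fun t ht h => hv ((mem_powersetCard.1 (hT ht)).1 h)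
  ext f
  by_cases hvf : v ∈ f
  · obtain ⟨g, hg, rfl⟩ : ∃ g, v ∉ g ∧ insert v g = f :=
      ⟨f.erase v, notMem_erase _ _, insert_erase hvf⟩
    have h1 : insert v g ∈ cone k A v (∂ T) ↔ g ∈ ∂ T := by
      simp only [cone, mem_union, mem_image, mem_powersetCard]
      constructor
      · rintro (h | ⟨t, ht, h⟩)
        · exact absurd (h.1 (mem_insert_self _ _)) hv
        · have hvt : v ∉ t := by
            obtain ⟨s, hs, hts⟩ := exists_subset_of_mem_shadow ht
            exact fun h => hvT s hs (hts h)
          rwa [← insert_injOn v hvt hg h]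
      · exact fun h => Or.inr ⟨g, h, rfl⟩
    rw [h1, mem_shadow_iff_insert_mem, mem_shadow_iff_insert_mem]
    constructor
    · rintro ⟨a, ha, h⟩
      rw [mem_insert, not_or] at ha
      rw [Finset.insert_comm, insert_mem_cone hv hT (by simp [hg, Ne.symm ha.1])] at h
      exact ⟨a, ha.2, h⟩
    · rintro ⟨a, ha, h⟩
      have hav : a ≠ v := by rintro rfl; exact hvT _ h (mem_insert_self _ _)
      refine ⟨a, by simp [ha, hav], ?_⟩
      rwa [Finset.insert_comm, insert_mem_cone hv hT (by simp [hg, hav.symm])]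
  · rw [mem_cone_of_notMem hvf]
    constructor
    · intro hf
      obtain ⟨a, ha, h⟩ := mem_shadow_iff_insert_mem.1 hf
      by_cases hav : a = v
      · subst hav
        exact hT ((insert_mem_cone hv hT hvf).1 h)
      · rw [mem_cone_of_notMem (by simp [hvf, Ne.symm hav])] at h
        exact shadow_powersetCard_subset (mem_shadow_iff_insert_mem.2 ⟨a, ha, h⟩)
    · intro hf
      rcases le_or_gt (k + 1) A.card with hA | hA
      · rw [← shadow_powersetCard hA] at hf
        exact shadow_mono subset_union_left hf
      · obtain ⟨t, ht⟩ := h.resolve_left (by omega)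
        have e : ∀ g ∈ powersetCard k A, g = A := fun g hg => by
          rw [mem_powersetCard] at hg
          exact eq_of_subset_of_card_le hg.1 (by omega)
        rw [(e f hf).trans (e t (hT ht)).symm]
        exact mem_shadow_iff_insert_mem.2
          ⟨v, hvT t ht, (insert_mem_cone hv hT (hvT t ht)).2 ht⟩

theorem card_shadow_cone (hv : v ∉ A) (hT : T ⊆ powersetCard k A)
    (h : k + 1 ≤ A.card ∨ T.Nonempty) :
    (∂ (cone (k + 1) A v T)).card = A.card.choose k + (∂ T).card := by
  rw [shadow_cone hv hT h]
  cases k with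
  | zero =>
    have : ∂ T = ∅ := by
      have : T ⊆ {∅} := by simpa using hT
      have := shadow_mono this
      rwa [shadow_singleton_empty, subset_empty] at this
    simp [cone, this]
  | succ k =>
    exact card_cone hv ((shadow_mono hT).trans shadow_powersetCard_subset)

end Cone

/-! ### The Kruskal-Katona theorem in terms of `kk` -/

section
variable {n : ℕ} {r : Fin n → ℕ} {k : ℕ} {S : Finset (Finset (Fin n))}

theorem toColex_insert_le_iff {β : Type*} [LinearOrder β] {a : β} {s t : Finset β} (hs : a ∉ s)
    (ht : a ∉ t) : toColex (insert a s) ≤ toColex (insert a t) ↔ toColex s ≤ toColex t := by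
  have h := toColex_sdiff_le_toColex_sdiff (s := insert a s) (t := insert a t) (u := {a})
    (by simp) (by simp)
  rw [← h, sdiff_singleton_eq_erase, sdiff_singleton_eq_erase, erase_insert hs, erase_insert ht]

theorem rank_notMem_image {α : Type*} [DecidableEq α] {r : α → ℕ} (hr : Function.Injective r)
    {v : α} {s : Finset α} (hv : v ∉ s) : r v ∉ s.image r := by
  simpa [hr.eq_iff] using hv

/-- A nonempty segment is a cone whose apex is the element of largest rank in its support. -/
theorem IsRankSeg.eq_cone (hr : Function.Injective r) (h : IsRankSeg r (k + 1) S)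
    (hS : S.Nonempty) : ∃ (v : Fin n) (T : Finset (Finset (Fin n))),
      T ⊆ powersetCard k {x | r x < r v} ∧ IsRankSeg r k T ∧ T.Nonempty ∧
      S = cone (k + 1) {x | r x < r v} v T := by
  obtain ⟨s₀, hs₀⟩ := hS
  obtain ⟨x₀, hx₀⟩ := card_pos.1 (by rw [h.1 hs₀]; omega : 0 < s₀.card)
  obtain ⟨v, hv, hmax⟩ := exists_max_image (S.biUnion id) r ⟨x₀, by simpa using ⟨s₀, hs₀, hx₀⟩⟩
  obtain ⟨s₁, hs₁, hvs₁⟩ : ∃ s ∈ S, v ∈ s := by simpa using hv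
  have hmax' : ∀ s ∈ S, ∀ x ∈ s, r x ≤ r v := fun s hs x hx =>
    hmax x (mem_biUnion.2 ⟨s, hs, hx⟩)
  have hlt : ∀ s, insert v s ∈ S → v ∉ s → ∀ x ∈ s, r x < r v := fun s hs hv x hx =>
    lt_of_le_of_ne (hmax' _ hs x (mem_insert_of_mem hx)) (fun e => hv (hr e ▸ hx))
  refine ⟨v, S.memberSubfamily v, ?_, ⟨?_, ?_⟩, ⟨s₁.erase v, ?_⟩, ?_⟩
  · intro s hs
    rw [mem_memberSubfamily] at hs
    refine mem_powersetCard.2 ⟨fun x hx => by simpa using hlt s hs.1 hs.2 x hx, ?_⟩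
    have := h.1 hs.1
    rw [card_insert_of_notMem hs.2] at this
    omega
  · intro s hs
    rw [mem_coe, mem_memberSubfamily] at hs
    have := h.1 hs.1
    rw [card_insert_of_notMem hs.2] at this
    omega
  · intro s hs t ht hts
    rw [mem_memberSubfamily] at hs ⊢
    have h1 : ∀ x ∈ t, r x < r v := by
      intro x hx
      refine forall_lt_mono hts (a := r v) ?_ (r x) (mem_image_of_mem r hx)
      intro b hb
      obtain ⟨y, hy, rfl⟩ := mem_image.1 hb
      exact hlt s hs.1 hs.2 y hy
    have h2 : v ∉ t := fun hv => lt_irrefl _ (h1 v hv)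
    refine ⟨h.2 _ hs.1 _ (by rw [card_insert_of_notMem h2, ht]) ?_, h2⟩
    rw [image_insert, image_insert, toColex_insert_le_iff (rank_notMem_image hr h2)
      (rank_notMem_image hr hs.2)]
    exact hts
  · rw [mem_memberSubfamily]
    exact ⟨by rwa [insert_erase hvs₁], notMem_erase _ _⟩
  · ext s
    simp only [cone, mem_union, mem_powersetCard, mem_image, mem_memberSubfamily]
    constructor
    · intro hs
      by_cases hvs : v ∈ s
      · exact Or.inr ⟨s.erase v, ⟨by rwa [insert_erase hvs], notMem_erase _ _⟩, insert_erase hvs⟩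
      · refine Or.inl ⟨fun x hx => ?_, h.1 hs⟩
        rw [mem_filter]
        exact ⟨mem_univ _, lt_of_le_of_ne (hmax' s hs x hx) (fun e => hvs (hr e ▸ hx))⟩
    · rintro (⟨hs, hc⟩ | ⟨t, ht, rfl⟩)
      · refine h.2 s₁ hs₁ s hc (toColex_lt_toColex_iff_exists_forall_lt.2
          ⟨r v, mem_image_of_mem r hvs₁, ?_, ?_⟩).le
        · intro hv
          obtain ⟨x, hx, e⟩ := mem_image.1 hv
          have := hs hx
          simp [e] at this
        · intro b hb _
          obtain ⟨x, hx, rfl⟩ := mem_image.1 hb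
          simpa using hs hx
      · exact ht.1

/-- Segments attain the Kruskal-Katona bound. -/
theorem IsRankSeg.card_shadow (hr : Function.Injective r) :
    ∀ {k : ℕ} {S : Finset (Finset (Fin n))}, IsRankSeg r k S → (∂ S).card = kk k S.card := by
  intro k
  induction k with
  | zero =>
    intro S h
    have : S ⊆ {∅} := fun s hs => by rw [mem_singleton, ← card_eq_zero]; exact h.1 hs
    have := shadow_mono this
    rw [shadow_singleton_empty, subset_empty] at this
    simp [this]
  | succ k ih =>
    intro S h
    rcases S.eq_empty_or_nonempty with rfl | hS
    · simp
    obtain ⟨v, T, hT, hTr, hne, rfl⟩ := h.eq_cone hr hS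
    have h1 := card_le_card hT
    rw [card_powersetCard] at h1
    have h2 := hne.card_pos
    rw [card_cone (by simp) hT, card_shadow_cone (by simp) hT (Or.inr hne), ih hTr]
    exact (kk_rec (by
      by_contra! hlt
      have := Nat.choose_eq_zero_of_lt hlt
      omega) h2 h1).symm

/-- The Kruskal-Katona theorem. -/
theorem kk_le_card_shadow (h : (S : Set (Finset (Fin n))).Sized k) :
    kk k S.card ≤ (∂ S).card := by
  have hr : Function.Injective (fun x : Fin n => (x : ℕ)) := Fin.val_injective
  have hle : S.card ≤ (powersetCard k (univ : Finset (Fin n))).card :=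
    card_le_card fun s hs => by simpa using h hs
  obtain ⟨T, -, hT, hTr⟩ := (isRankSeg_powersetCard_univ (fun x : Fin n => (x : ℕ)) k).exists_card
    hr hle
  rw [← hT, ← hTr.card_shadow hr]
  refine kruskal_katona h hT.le ?_
  have := (isRankSeg_comp_iff (σ := Equiv.refl _) (k := k) (S := T) Fin.val_strictMono).1
    (by simpa using hTr)
  simpa using this

/-- The sets of least rank lie in every segment. -/
theorem IsRankSeg.mem_of_lower (hr : Function.Injective r) (h : IsRankSeg r k S) (hS : S.Nonempty)
    {f : Finset (Fin n)} (hf : f.card = k) (hlow : ∀ x ∈ f, ∀ y, r y < r x → y ∈ f) : f ∈ S := by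
  obtain ⟨s, hs⟩ := hS
  refine h.2 s hs f hf ?_
  rw [toColex_le_toColex]
  intro a ha has
  obtain ⟨x, hx, rfl⟩ := mem_image.1 ha
  have hxs : x ∉ s := fun hx => has (mem_image_of_mem r hx)
  have h1 : ¬ s ⊆ f := fun hsf => hxs (by
    rw [eq_of_subset_of_card_le hsf (by rw [hf, h.1 hs])]; exact hx)
  obtain ⟨y, hy, hyf⟩ := not_subset.1 h1
  refine ⟨r y, mem_image_of_mem r hy, rank_notMem_image hr hyf, ?_⟩
  by_contra! hlt
  exact hyf (hlow x hx y hlt)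

/-- Two families that share exactly one set of their shadows show that `kk` is strictly
subadditive. -/
theorem kk_add_lt {k x y : ℕ} (hk : 1 ≤ k) (hx : 1 ≤ x) (hy : 1 ≤ y) :
    kk k (x + y) < kk k x + kk k y := by
  obtain ⟨k, rfl⟩ : ∃ l, k = l + 1 := ⟨k - 1, by omega⟩
  set N := x + y + k with hN
  -- The first family lives on `[0, N)`, the second one on `[0, k) ∪ [N, 2 N)`.
  let r : Fin (2 * N) → ℕ := fun i => i
  let q : Fin (2 * N) → ℕ := fun i => if (i : ℕ) < k ∨ N ≤ i then i else i + 2 * N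
  have hr : Function.Injective r := Fin.val_injective
  have hq : Function.Injective q := by
    intro i j h
    simp only [q] at h
    apply Fin.ext
    have := i.2
    have := j.2
    split_ifs at h <;> omega
  have hX := isRankSeg_powersetCard r (k + 1) N
  have hY := isRankSeg_powersetCard q (k + 1) (2 * N)
  have hA : N ≤ (univ.filter fun i => r i < N).card := by
    have : ((univ : Finset (Fin N)).image (Fin.castLE (by omega : N ≤ 2 * N))) ⊆
        univ.filter fun i => r i < N := by
      intro i hi
      obtain ⟨j, _, rfl⟩ := mem_image.1 hi
      simp [r]
    have h2 := card_le_card this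
    rwa [card_image_of_injective _ (Fin.castLE_injective _), card_univ, Fintype.card_fin] at h2
  have hB : N ≤ (univ.filter fun i => q i < 2 * N).card := by
    have : ((univ : Finset (Fin N)).image
        (fun i : Fin N => (⟨i + N, by omega⟩ : Fin (2 * N)))) ⊆ univ.filter fun i => q i < 2 * N := by
      intro i hi
      obtain ⟨j, _, rfl⟩ := mem_image.1 hi
      have := j.2
      simp only [q, mem_filter, mem_univ, true_and]
      rw [if_pos (by simp)]
      omega
    have h2 := card_le_card this
    rwa [card_image_of_injective _ (fun i j h => by
      have := congrArg Fin.val h; simp only at this; exact Fin.ext (by omega)),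
      card_univ, Fintype.card_fin] at h2
  have hN' := le_choose_add N k
  obtain ⟨X, hXs, hXc, hXr⟩ := hX.exists_card hr (x := x) (by
    rw [card_powersetCard]
    have := Nat.choose_le_choose (k + 1) hA
    omega)
  obtain ⟨Y, hYs, hYc, hYr⟩ := hY.exists_card hq (x := y) (by
    rw [card_powersetCard]
    have := Nat.choose_le_choose (k + 1) hB
    omega)
  let f : Finset (Fin (2 * N)) := univ.filter fun i => (i : ℕ) < k
  have hf : f.card = k := by
    have h1 : f = (univ : Finset (Fin k)).image (Fin.castLE (by omega : k ≤ 2 * N)) := by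
      ext i
      simp only [f, mem_filter, mem_univ, true_and, mem_image]
      exact ⟨fun h => ⟨⟨i, h⟩, rfl⟩, by rintro ⟨j, rfl⟩; exact j.2⟩
    rw [h1, card_image_of_injective _ (Fin.castLE_injective _), card_univ, Fintype.card_fin]
  have hne : ∀ (r : Fin (2 * N) → ℕ) (Z : Finset (Finset (Fin (2 * N)))), IsRankSeg r (k + 1) Z →
      1 ≤ Z.card → (∂ Z).Nonempty := by
    intro r Z hZ h1
    obtain ⟨s, hs⟩ := card_pos.1 h1
    obtain ⟨a, ha⟩ := card_pos.1 (by rw [hZ.1 hs]; omega : 0 < s.card)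
    exact ⟨_, erase_mem_shadow hs ha⟩
  have hfX : f ∈ ∂ X := by
    refine (hXr.shadow hr).mem_of_lower hr (hne r X hXr (by omega)) hf ?_
    intro i hi j hj
    simp only [f, mem_filter, mem_univ, true_and, r] at hi hj ⊢
    omega
  have hfY : f ∈ ∂ Y := by
    refine (hYr.shadow hq).mem_of_lower hq (hne q Y hYr (by omega)) hf ?_
    intro i hi j hj
    simp only [f, mem_filter, mem_univ, true_and, q] at hi hj ⊢
    split_ifs at hj <;> omega
  have hdisj : Disjoint X Y := by
    rw [disjoint_left]
    intro s hs hs'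
    have h1 := mem_powersetCard.1 (hXs hs)
    have h2 := mem_powersetCard.1 (hYs hs')
    have h3 : s ⊆ f := by
      intro i hi
      have h4 := h1.1 hi
      have h5 := h2.1 hi
      simp only [mem_filter, mem_univ, true_and, r, q, f] at h4 h5 ⊢
      split_ifs at h5 <;> omega
    have := card_le_card h3
    omega
  have hsize : ((X ∪ Y : Finset (Finset (Fin (2 * N)))) :
      Set (Finset (Fin (2 * N)))).Sized (k + 1) := by
    intro s hs
    rcases mem_union.1 (mem_coe.1 hs) with hs | hs
    · exact hXr.1 hs
    · exact hYr.1 hs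
  have h1 := kk_le_card_shadow hsize
  rw [card_union_of_disjoint hdisj, hXc, hYc] at h1
  have h2 : ∂ (X ∪ Y) ⊆ ∂ X ∪ (∂ Y).erase f := by
    intro t ht
    obtain ⟨s, hs, a, ha, rfl⟩ := mem_shadow_iff.1 ht
    rcases mem_union.1 hs with hs | hs
    · exact mem_union_left _ (erase_mem_shadow hs ha)
    · by_cases e : s.erase a = f
      · rw [e]; exact mem_union_left _ hfX
      · exact mem_union_right _ (mem_erase.2 ⟨e, erase_mem_shadow hs ha⟩)
  have h3 := (card_le_card h2).trans (card_union_le _ _)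
  rw [hXr.card_shadow hr, card_erase_of_mem hfY, hYr.card_shadow hq, hXc, hYc] at h3
  have h4 : 0 < (∂ Y).card := card_pos.2 ⟨f, hfY⟩
  rw [hYr.card_shadow hq, hYc] at h4
  omega

end

/-! ### Links, deletions and cones over cliques -/

section Link
variable {α : Type*} [DecidableEq α] {S : Finset (Finset α)} {v : α} {k : ℕ}

theorem memberSubfamily_shadow : (∂ S).memberSubfamily v = ∂ (S.memberSubfamily v) := by
  ext t
  simp only [mem_memberSubfamily, mem_shadow_iff_insert_mem]
  constructor
  · rintro ⟨⟨a, ha, h⟩, hv⟩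
    rw [mem_insert, not_or] at ha
    rw [Finset.insert_comm] at h
    exact ⟨a, ha.2, h, by simp [hv, Ne.symm ha.1]⟩
  · rintro ⟨a, ha, h, hv⟩
    rw [mem_insert, not_or] at hv
    rw [Finset.insert_comm] at h
    exact ⟨⟨a, by simp [ha, Ne.symm hv.1], h⟩, hv.2⟩

theorem nonMemberSubfamily_shadow : (∂ S).nonMemberSubfamily v =
    S.memberSubfamily v ∪ ∂ (S.nonMemberSubfamily v) := by
  ext t
  simp only [mem_memberSubfamily, mem_nonMemberSubfamily, mem_shadow_iff_insert_mem, mem_union]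
  constructor
  · rintro ⟨⟨a, ha, h⟩, hv⟩
    by_cases e : a = v
    · subst e; exact Or.inl ⟨h, hv⟩
    · exact Or.inr ⟨a, ha, h, by simp [hv, Ne.symm e]⟩
  · rintro (⟨h, hv⟩ | ⟨a, ha, h, hv⟩)
    · exact ⟨⟨v, hv, h⟩, hv⟩
    · rw [mem_insert, not_or] at hv
      exact ⟨⟨a, ha, h⟩, hv.2⟩

theorem card_shadow_eq_link_add (S : Finset (Finset α)) (v : α) : (∂ S).card =
    (∂ (S.memberSubfamily v)).card +
      (S.memberSubfamily v ∪ ∂ (S.nonMemberSubfamily v)).card := by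
  rw [← memberSubfamily_shadow, ← nonMemberSubfamily_shadow,
    card_memberSubfamily_add_card_nonMemberSubfamily]

theorem sized_memberSubfamily (h : (S : Set (Finset α)).Sized (k + 1)) :
    (S.memberSubfamily v : Set (Finset α)).Sized k := by
  intro s hs
  rw [mem_coe, mem_memberSubfamily] at hs
  have := h hs.1
  rw [card_insert_of_notMem hs.2] at this
  omega

theorem sized_nonMemberSubfamily (h : (S : Set (Finset α)).Sized k) :
    (S.nonMemberSubfamily v : Set (Finset α)).Sized k := fun _ hs =>
  h (mem_nonMemberSubfamily.1 (mem_coe.1 hs)).1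

end Link

section
variable {n k : ℕ} {S : Finset (Finset (Fin n))}

/-- An extremal family that contains all `k`-subsets of a sufficiently large set `A` is a cone: a
second vertex outside of `A` would contradict the strict subadditivity of `kk`. -/
theorem eq_cone_of_clique {A : Finset (Fin n)} (hS : (S : Set (Finset (Fin n))).Sized (k + 2))
    (hext : (∂ S).card = kk (k + 2) S.card) (hA : powersetCard (k + 2) A ⊆ S)
    (hcard : S.card ≤ (A.card + 1).choose (k + 2)) (hAk : k + 2 ≤ A.card) :
    S = powersetCard (k + 2) A ∨ ∃ v ∉ A, ∃ T ⊆ powersetCard (k + 1) A, T.Nonempty ∧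
      (∂ T).card = kk (k + 1) T.card ∧ S = cone (k + 2) A v T := by
  by_cases hSA : S ⊆ powersetCard (k + 2) A
  · exact Or.inl (subset_antisymm hSA hA)
  right
  obtain ⟨s₀, hs₀, hs₀A⟩ := not_subset.1 hSA
  obtain ⟨v, hv, hvA⟩ : ∃ v ∈ s₀, v ∉ A := by
    by_contra! h
    exact hs₀A (mem_powersetCard.2 ⟨h, hS hs₀⟩)
  set T := S.memberSubfamily v with hT
  set R := S.nonMemberSubfamily v with hR
  have hTne : T.Nonempty :=
    ⟨s₀.erase v, mem_memberSubfamily.2 ⟨by rwa [insert_erase hv], notMem_erase _ _⟩⟩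
  have hsum : T.card + R.card = S.card := card_memberSubfamily_add_card_nonMemberSubfamily v S
  have hAR : powersetCard (k + 2) A ⊆ R := fun s hs =>
    mem_nonMemberSubfamily.2 ⟨hA hs, fun h => hvA ((mem_powersetCard.1 hs).1 h)⟩
  have hARc := card_le_card hAR
  rw [card_powersetCard] at hARc
  obtain ⟨y, hy⟩ : ∃ y, R.card = A.card.choose (k + 2) + y := ⟨R.card - A.card.choose (k + 2), by omega⟩
  have hsh := card_shadow_eq_link_add S v
  rw [← hT, ← hR] at hsh
  have hTs : (T : Set (Finset (Fin n))).Sized (k + 1) := sized_memberSubfamily hS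
  have h1 := kk_le_card_shadow hTs
  have h2 := kk_le_card_shadow (sized_nonMemberSubfamily (v := v) hS)
  rw [← hR, hy] at h2
  have h3 : (∂ R).card ≤ (T ∪ ∂ R).card := card_le_card subset_union_right
  have hTpos := hTne.card_pos
  have hch : (A.card + 1).choose (k + 2) = A.card.choose (k + 1) + A.card.choose (k + 2) :=
    Nat.choose_succ_succ' _ _
  have h4 : kk (k + 2) S.card = A.card.choose (k + 1) + kk (k + 1) (T.card + y) := by
    rw [← hsum, hy, show T.card + (A.card.choose (k + 2) + y) =
      A.card.choose (k + 2) + (T.card + y) by omega]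
    exact kk_rec (by omega) (by omega) (by omega)
  have hy0 : y = 0 := by
    by_contra hne
    rw [kk_rec (by omega) (by omega) (by omega)] at h2
    have := kk_add_lt (k := k + 1) (x := T.card) (y := y) (by omega) hTpos (by omega)
    omega
  subst hy0
  simp only [Nat.add_zero] at hy h4
  have hRA : R = powersetCard (k + 2) A :=
    (eq_of_subset_of_card_le hAR (by rw [card_powersetCard, hy])).symm
  rw [hRA, shadow_powersetCard hAk] at hsh
  have h5 : (powersetCard (k + 1) A).card ≤ (T ∪ powersetCard (k + 1) A).card :=
    card_le_card subset_union_right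
  rw [card_powersetCard] at h5
  have h6 : powersetCard (k + 1) A = T ∪ powersetCard (k + 1) A :=
    eq_of_subset_of_card_le subset_union_right (by rw [card_powersetCard]; omega)
  have hTA : T ⊆ powersetCard (k + 1) A := by rw [h6]; exact subset_union_left
  refine ⟨v, hvA, T, hTA, hTne, by omega, ?_⟩
  ext s
  by_cases hvs : v ∈ s
  · rw [← insert_erase hvs, insert_mem_cone hvA hTA (notMem_erase _ _), hT, mem_memberSubfamily]
    simp
  · rw [mem_cone_of_notMem hvs, ← hRA, hR, mem_nonMemberSubfamily]
    simp [hvs]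

/-! ### Cones over colex segments -/

theorem isRankSeg_cone {r : Fin n → ℕ} (hr : Function.Injective r) {v : Fin n}
    {T : Finset (Finset (Fin n))} (hT : T ⊆ powersetCard k {x | r x < r v})
    (h : IsRankSeg r k T) : IsRankSeg r (k + 1) (cone (k + 1) {x | r x < r v} v T) := by
  have hvT : ∀ t ∈ T, v ∉ t := fun t ht hv => by
    simpa using (mem_powersetCard.1 (hT ht)).1 hv
  constructor
  · intro s hs
    rcases mem_union.1 (mem_coe.1 hs) with hs | hs
    · exact (mem_powersetCard.1 hs).2
    · obtain ⟨t, ht, rfl⟩ := mem_image.1 hs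
      rw [card_insert_of_notMem (hvT t ht), h.1 ht]
  · intro s hs t ht hts
    have hle : ∀ x ∈ s, r x ≤ r v := by
      intro x hx
      rcases mem_union.1 hs with hs | hs
      · have := (mem_powersetCard.1 hs).1 hx
        simp only [mem_filter] at this
        exact this.2.le
      · obtain ⟨u, hu, rfl⟩ := mem_image.1 hs
        rcases mem_insert.1 hx with rfl | hx
        · exact le_rfl
        · have := (mem_powersetCard.1 (hT hu)).1 hx
          simp only [mem_filter] at this
          exact this.2.le
    by_cases hvt : v ∈ t
    · by_cases hvs : v ∈ s
      · obtain ⟨s, hs', rfl⟩ : ∃ u, v ∉ u ∧ insert v u = s :=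
          ⟨s.erase v, notMem_erase _ _, insert_erase hvs⟩
        obtain ⟨t, ht', rfl⟩ : ∃ u, v ∉ u ∧ insert v u = t :=
          ⟨t.erase v, notMem_erase _ _, insert_erase hvt⟩
        rw [insert_mem_cone (by simp) hT hs'] at hs
        rw [insert_mem_cone (by simp) hT ht']
        rw [card_insert_of_notMem ht'] at ht
        refine h.2 s hs t (by omega) ?_
        rwa [image_insert, image_insert, toColex_insert_le_iff (rank_notMem_image hr ht')
          (rank_notMem_image hr hs')] at hts
      · exfalso
        have := forall_lt_mono hts (a := r v) (by
          intro b hb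
          obtain ⟨x, hx, rfl⟩ := mem_image.1 hb
          exact lt_of_le_of_ne (hle x hx) (fun e => hvs (hr e ▸ hx))) (r v)
          (mem_image_of_mem r hvt)
        omega
    · rw [mem_cone_of_notMem hvt, mem_powersetCard]
      refine ⟨fun x hx => ?_, ht⟩
      have := forall_le_mono hts (a := r v) (by
        intro b hb
        obtain ⟨x, hx, rfl⟩ := mem_image.1 hb
        exact hle x hx) (r x) (mem_image_of_mem r hx)
      simp only [mem_filter, mem_univ, true_and]
      exact lt_of_le_of_ne this (fun e => hvt (hr e ▸ hx))

theorem isColexSegment_powersetCard (A : Finset (Fin n)) (k : ℕ) :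
    IsColexSegment k (powersetCard k A) := by
  let r : Fin n → ℕ := fun x => if x ∈ A then x else n + x
  refine isColexSegment_iff.2 ⟨r, ?_, ?_⟩
  · intro x y h
    have := x.2
    have := y.2
    apply Fin.ext
    simp only [r] at h
    split_ifs at h <;> omega
  · have : A = univ.filter fun x => r x < n := by
      ext x
      simp only [mem_filter, mem_univ, true_and, r]
      split_ifs with h <;> simp [h]
    rw [this]
    exact isRankSeg_powersetCard r k n

theorem isColexSegment_cone {A : Finset (Fin n)} {v : Fin n} {T : Finset (Finset (Fin n))}
    (hv : v ∉ A) (hT : T ⊆ powersetCard k A) (h : IsColexSegment k T) :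
    IsColexSegment (k + 1) (cone (k + 1) A v T) := by
  obtain ⟨r, hr, h⟩ := isColexSegment_iff.1 h
  obtain ⟨M, hM⟩ : ∃ M, ∀ x, r x < M :=
    ⟨univ.sup r + 1, fun x => Nat.lt_succ_of_le (le_sup (mem_univ x))⟩
  -- The new ranking starts with the support of `T`, ranked as before, the rest of `A` and `v`.
  let q : Fin n → ℕ := fun x => if x ∈ support T then r x else if x ∈ A then M + r x else
    if x = v then 2 * M else 2 * M + 1 + r x
  have hq : Function.Injective q := by
    intro x y hxy
    have := hM x
    have := hM y
    have hxy' : r x = r y → x = y := fun h => hr h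
    simp only [q] at hxy
    split_ifs at hxy with h1 h2 h3 h4 h5 h6 h7 h8 h9 <;>
      first | (subst_vars; rfl) | (apply hxy'; omega)
  have hsupp : ∀ t ∈ T, ∀ x ∈ t, x ∈ support T := fun t ht x hx =>
    mem_biUnion.2 ⟨t, ht, hx⟩
  have hsA : support T ⊆ A := by
    intro x hx
    obtain ⟨t, ht, hxt⟩ := mem_biUnion.1 hx
    exact (mem_powersetCard.1 (hT ht)).1 hxt
  have hqv : q v = 2 * M := by
    simp only [q]
    rw [if_neg (fun h => hv (hsA h)), if_neg hv]
    simp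
  have hA : A = univ.filter fun x => q x < q v := by
    ext x
    simp only [mem_filter, mem_univ, true_and, hqv]
    have := hM x
    simp only [q]
    split_ifs with h1 h2 h3
    · simp only [hsA h1, true_iff]; omega
    · simp only [h2, true_iff]; omega
    · simp [h2]
    · simp only [h2, false_iff]; omega
  have hTq : IsRankSeg q k T := by
    refine ⟨h.1, fun s hs t ht hts => ?_⟩
    have e : ∀ u : Finset (Fin n), u ⊆ support T → u.image q = u.image r := by
      intro u hu
      refine image_congr fun x hx => ?_
      simp only [q]
      rw [if_pos (hu hx)]
    have hts' : t ⊆ support T := by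
      intro x hx
      have h1 := forall_lt_mono hts (a := M) (by
        rw [e s (fun x hx => hsupp s hs x hx)]
        intro b hb
        obtain ⟨y, _, rfl⟩ := mem_image.1 hb
        exact hM y) (q x) (mem_image_of_mem q hx)
      by_contra hx'
      simp only [q] at h1
      rw [if_neg hx'] at h1
      split_ifs at h1 <;> omega
    rw [e s (fun x hx => hsupp s hs x hx), e t hts'] at hts
    exact h.2 s hs t ht hts
  refine isColexSegment_iff.2 ⟨q, hq, ?_⟩
  rw [hA] at hT ⊢
  exact isRankSeg_cone hq hT hTq

end

/-! ### Cliques in shifted families -/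

/-- The sizes of the deletions of the first vertex keep a short decomposition. -/
theorem len_sub_maxDeg_le {k m : ℕ} (h : k = 0 → m = 0) : len k (m - maxDeg k m) ≤ len k m := by
  refine cascade_induction (P := fun k m => len k (m - maxDeg k m) ≤ len k m) ?_ ?_ k m h
  · simp
  · intro k a x ha hx ih
    have hk : k = 0 → x = 0 := by rintro rfl; simpa using hx
    obtain ⟨b, rfl⟩ : ∃ c, a = c + 1 := ⟨a - 1, by omega⟩
    have h1 := sub_maxDeg_lt hk (by omega : k ≤ b) hx
    have h2 := maxDeg_le hk
    rw [maxDeg_cascade ha hx, len_cascade ha hx, Nat.add_sub_cancel, Nat.choose_succ_succ' b k,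
      show b.choose k + b.choose (k + 1) + x - (b.choose k + maxDeg k x) =
        b.choose (k + 1) + (x - maxDeg k x) by omega]
    rcases (show k ≤ b by omega).eq_or_lt with rfl | hkb
    · rw [Nat.choose_self] at h1
      rw [Nat.choose_succ_self, show x - maxDeg k x = 0 by omega]
      simp
    · rw [len_cascade hkb h1]
      omega

section
variable {n k : ℕ} {S : Finset (Finset (Fin n))}

/-- A shifted family with a shadow smaller than that of every larger family contains all subsets of
a large set. Both the link and the deletion of the first vertex have exactly the sizes they have in
a colex segment, and the deletion satisfies the same hypotheses. -/
theorem exists_clique_of_shifted (G : Finset (Fin n)) : ∀ S : Finset (Finset (Fin n)),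
    (∀ s ∈ S, s ⊆ G) → (S : Set (Finset (Fin n))).Sized (k + 1) → S.Nonempty →
    (∀ i ∈ G, ∀ j ∈ G, i < j → ∀ s ∈ S, j ∈ s → i ∉ s → insert i (s.erase j) ∈ S) →
    len (k + 1) S.card ≤ k → (∂ S).card < kk (k + 1) (S.card + 1) →
    ∃ A : Finset (Fin n), A.card = lead (k + 1) S.card ∧ powersetCard (k + 1) A ⊆ S := by
  induction G using Finset.induction_on_min with
  | empty =>
    intro S hSG hS hne
    obtain ⟨s, hs⟩ := hne
    have h1 := hS hs
    rw [subset_empty.1 (hSG s hs)] at h1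
    simp at h1
  | insert t G ht ih =>
    intro S hSG hS hne hsh hlen hlt
    set L := S.memberSubfamily t with hL
    set R := S.nonMemberSubfamily t with hR
    have hRG : ∀ s ∈ R, s ⊆ G := by
      intro s hs x hx
      rw [hR, mem_nonMemberSubfamily] at hs
      rcases mem_insert.1 (hSG s hs.1 hx) with rfl | h
      · exact absurd hx hs.2
      · exact h
    have hRs : (R : Set (Finset (Fin n))).Sized (k + 1) := sized_nonMemberSubfamily hS
    have hRL : ∂ R ⊆ L := by
      intro f hf
      obtain ⟨y, hy, h⟩ := mem_shadow_iff_insert_mem.1 hf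
      have hyG : y ∈ G := hRG _ h (mem_insert_self _ _)
      rw [hR, mem_nonMemberSubfamily, mem_insert, not_or] at h
      have h1 := hsh t (mem_insert_self _ _) y (mem_insert_of_mem hyG) (ht y hyG) _ h.1
        (mem_insert_self _ _) (by simpa using h.2)
      rw [erase_insert hy] at h1
      exact mem_memberSubfamily.2 ⟨h1, h.2.2⟩
    have hsum : L.card + R.card = S.card := card_memberSubfamily_add_card_nonMemberSubfamily t S
    have hcs := card_shadow_eq_link_add S t
    rw [← hL, ← hR, union_eq_left.2 hRL] at hcs
    have hmd := maxDeg_le (k := k + 1) (m := S.card) (by simp)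
    have h1 : L.card ≤ maxDeg (k + 1) S.card := by
      by_contra! h
      have h2 := kk_succ_le_maxDeg hlen
      have h3 := kk_mono k (show maxDeg (k + 1) S.card + 1 ≤ L.card from h)
      have h4 := kk_le_card_shadow (S := L) (sized_memberSubfamily hS)
      omega
    have h2 : R.card ≤ S.card - maxDeg (k + 1) S.card := by
      by_contra! h
      have h3 := maxDeg_lt_kk hlen
      have h4 := kk_mono (k + 1) (show S.card - maxDeg (k + 1) S.card + 1 ≤ R.card from h)
      have h5 := kk_le_card_shadow hRs
      have h6 := card_le_card hRL
      omega
    have h3 : R.card = S.card - maxDeg (k + 1) S.card := by omega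
    obtain ⟨a, x, ha, hx, hm⟩ := exists_cascade (k := k) hne.card_pos.ne'
    have hlead : lead (k + 1) S.card = a := by rw [hm, lead_add hx]
    rcases ha.eq_or_lt with rfl | ha'
    · obtain ⟨s, hs⟩ := hne
      refine ⟨s, by rw [hlead, hS hs], ?_⟩
      rw [← hS hs, powersetCard_self]
      simpa using hs
    obtain ⟨b, rfl⟩ : ∃ c, a = c + 1 := ⟨a - 1, by omega⟩
    have hk : k = 0 → x = 0 := by rintro rfl; simpa using hx
    have h4 := sub_maxDeg_lt hk (by omega : k ≤ b) hx
    have h5 : R.card = b.choose (k + 1) + (x - maxDeg k x) := by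
      have := maxDeg_le hk
      rw [h3, hm, maxDeg_cascade ha hx, Nat.add_sub_cancel, Nat.choose_succ_succ' b k]
      omega
    have h6 : 0 < b.choose (k + 1) := Nat.choose_pos (by omega)
    obtain ⟨A, hA, hAR⟩ := ih R hRG hRs (card_pos.1 (by omega))
      (fun i hi j hj hij s hs hjs his => by
        rw [hR, mem_nonMemberSubfamily] at hs ⊢
        refine ⟨hsh i (mem_insert_of_mem hi) j (mem_insert_of_mem hj) hij s hs.1 hjs his, ?_⟩
        simp [(ht i hi).ne, hs.2])
      (by rw [h3]; exact (len_sub_maxDeg_le (by simp)).trans hlen)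
      (by
        have := maxDeg_lt_kk hlen
        rw [← h3] at this
        have := card_le_card hRL
        omega)
    rw [h5, lead_add h4] at hA
    have htA : t ∉ A := by
      intro htA
      obtain ⟨s, hts, hsA, hs⟩ := exists_subsuperset_card_eq (s := {t}) (t := A) (n := k + 1)
        (by simpa using htA) (by simp) (by omega)
      have := hAR (mem_powersetCard.2 ⟨hsA, hs⟩)
      rw [hR, mem_nonMemberSubfamily] at this
      exact this.2 (by simpa using hts)
    refine ⟨insert t A, by rw [card_insert_of_notMem htA, hA, hlead], fun s hs => ?_⟩
    rw [mem_powersetCard] at hs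
    by_cases hts : t ∈ s
    · have h7 : s.erase t ⊆ A := by
        intro y hy
        rw [mem_erase] at hy
        exact (mem_insert.1 (hs.1 hy.2)).resolve_left hy.1
      have h8 : (s.erase t).card = k := by rw [card_erase_of_mem hts, hs.2]; rfl
      obtain ⟨y, hy, hys⟩ := exists_mem_notMem_of_card_lt_card (s := s.erase t) (t := A) (by omega)
      have h9 : insert y (s.erase t) ∈ R :=
        hAR (mem_powersetCard.2 ⟨insert_subset hy h7, by rw [card_insert_of_notMem hys, h8]⟩)
      have h10 := hRL (mem_shadow_iff_insert_mem.2 ⟨y, hys, h9⟩)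
      rw [hL, mem_memberSubfamily, insert_erase hts] at h10
      exact h10.1
    · have h7 : s ⊆ A := fun y hy =>
        (mem_insert.1 (hs.1 hy)).resolve_left (by rintro rfl; exact hts hy)
      have := hAR (mem_powersetCard.2 ⟨h7, hs.2⟩)
      rw [hR, mem_nonMemberSubfamily] at this
      exact this.1

/-! ### Connectivity of the complement of a segment -/

/-- If all facets of `s` lie in the shadow of an extremal family whose decomposition is not of full
length, then `s` belongs to the family: adding it would not enlarge the shadow. -/
theorem mem_of_facets_mem_shadow (hS : (S : Set (Finset (Fin n))).Sized (k + 1))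
    (hext : (∂ S).card = kk (k + 1) S.card) (hlen : len (k + 1) S.card ≤ k)
    {s : Finset (Fin n)} (hs : s.card = k + 1) (h : ∀ x ∈ s, s.erase x ∈ ∂ S) : s ∈ S := by
  by_contra hsS
  have h1 : ((insert s S : Finset (Finset (Fin n))) : Set (Finset (Fin n))).Sized (k + 1) := by
    intro t ht
    rcases mem_insert.1 (mem_coe.1 ht) with rfl | ht
    · exact hs
    · exact hS ht
  have h2 : ∂ (insert s S) ⊆ ∂ S := by
    intro f hf
    obtain ⟨t, ht, a, ha, rfl⟩ := mem_shadow_iff.1 hf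
    rcases mem_insert.1 ht with rfl | ht
    · exact h a ha
    · exact erase_mem_shadow ht ha
  have h3 := kk_le_card_shadow h1
  rw [card_insert_of_notMem hsS] at h3
  have h4 := card_le_card h2
  have h5 := kk_succ (k := k + 1) (m := S.card) (by simp)
  omega

/-- The non-members of a segment `J` contained in `Y` are connected via facets outside of the shadow
of `J`: the set `f = s \ {min s}` is such a facet, so the minimum of `s` can be replaced by any
larger element, until the greatest subset of `Y` is reached. -/
theorem connected_compl {r : Fin n → ℕ} (hr : Function.Injective r)
    {J : Finset (Finset (Fin n))} (hJ : IsRankSeg r (k + 1) J)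
    (hfill : ∀ s : Finset (Fin n), s.card = k + 1 → (∀ x ∈ s, s.erase x ∈ ∂ J) → s ∈ J)
    {Y : Finset (Fin n)} {P : Finset (Fin n) → Prop}
    (hP : ∀ f ⊆ Y, f.card = k → f ∉ ∂ J → ∀ x ∈ Y, x ∉ f → ∀ y ∈ Y, y ∉ f →
      P (insert x f) → P (insert y f))
    {s t : Finset (Fin n)} (hs : s ∈ powersetCard (k + 1) Y) (ht : t ∈ powersetCard (k + 1) Y)
    (hsJ : s ∉ J) (htJ : t ∉ J) (hPs : P s) : P t := by
  obtain ⟨top, htop, hmax⟩ := exists_max_image (powersetCard (k + 1) Y)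
    (fun s => toColex (s.image r)) ⟨s, hs⟩
  suffices key : ∀ u ∈ powersetCard (k + 1) Y, u ∉ J → (P u ↔ P top) from
    (key t ht htJ).2 ((key s hs hsJ).1 hPs)
  clear hs ht hsJ htJ hPs s t
  classical
  by_contra! hbad
  obtain ⟨u₀, hu₀, hu₀J, hu₀P⟩ := hbad
  obtain ⟨s, hs, hsmax⟩ := exists_max_image
    ((powersetCard (k + 1) Y).filter fun u => u ∉ J ∧ ¬ (P u ↔ P top))
    (fun s => toColex (s.image r)) ⟨u₀, by
      rw [mem_filter]; exact ⟨hu₀, hu₀J, fun h => by tauto⟩⟩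
  rw [mem_filter] at hs
  obtain ⟨hsY, hsJ, hsP⟩ := hs
  have hs' := mem_powersetCard.1 hsY
  have htop' := mem_powersetCard.1 htop
  obtain ⟨m, hm, hmin⟩ := exists_min_image s r (card_pos.1 (by omega))
  have hmf : m ∉ s.erase m := notMem_erase _ _
  have hfc : (s.erase m).card = k := by rw [card_erase_of_mem hm, hs'.2]; rfl
  -- Exchanging the minimum of `s` for an element of higher rank increases `s`.
  have hup : ∀ x ∉ s, r m < r x → insert x (s.erase m) ∉ J := by
    intro x hxs hmx hxJ
    refine hsJ (hJ.2 _ hxJ s hs'.2 ?_)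
    have hxf : x ∉ s.erase m := fun h => hxs (mem_of_mem_erase h)
    conv_lhs => rw [← insert_erase hm]
    rw [image_insert, image_insert, Colex.insert_le_insert (rank_notMem_image hr hmf)
      (rank_notMem_image hr hxf)]
    exact hmx.le
  have hf : s.erase m ∉ ∂ J := by
    intro hf
    obtain ⟨x, hx, hxJ⟩ := mem_shadow_iff_insert_mem.1 hf
    have hxm : x ≠ m := by
      rintro rfl
      rw [insert_erase hm] at hxJ
      exact hsJ hxJ
    have hxs : x ∉ s := fun h => hx (mem_erase.2 ⟨hxm, h⟩)
    have hlt : r x < r m := by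
      rcases lt_trichotomy (r x) (r m) with h | h | h
      · exact h
      · exact absurd (hr h) hxm
      · exact absurd hxJ (hup x hxs h)
    refine hsJ (hfill s hs'.2 fun u hu => ?_)
    rcases eq_or_ne u m with rfl | hum
    · exact hf
    have hxu : x ∉ s.erase u := fun h => hxs (mem_of_mem_erase h)
    refine mem_shadow_iff_insert_mem.2 ⟨x, hxu, hJ.2 _ hxJ _ ?_ ?_⟩
    · rw [card_insert_of_notMem hxu, card_erase_of_mem hu, hs'.2]; rfl
    · rw [image_insert, image_insert, toColex_insert_le_iff (rank_notMem_image hr hxu)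
        (rank_notMem_image hr hx), image_erase hr, image_erase hr,
        Colex.erase_le_erase (mem_image_of_mem r hu) (mem_image_of_mem r hm)]
      exact hmin u hu
  have hne : s ≠ top := by rintro rfl; exact hsP Iff.rfl
  have hlt : toColex (s.image r) < toColex (top.image r) :=
    lt_of_le_of_ne (hmax s hsY) fun h => hne (Finset.image_injective hr (toColex_inj.1 h))
  obtain ⟨_, ha, has, hab⟩ := toColex_lt_toColex_iff_exists_forall_lt.1 hlt
  obtain ⟨y, hy, rfl⟩ := mem_image.1 ha
  have hys : y ∉ s := fun h => has (mem_image_of_mem r h)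
  obtain ⟨b, hbs, hbt⟩ : ∃ b ∈ s, b ∉ top := by
    by_contra! h
    exact hne (eq_of_subset_of_card_le h (by rw [hs'.2, htop'.2]))
  have hmy : r m < r y :=
    (hmin b hbs).trans_lt (hab (r b) (mem_image_of_mem r hbs) (rank_notMem_image hr hbt))
  have hyf : y ∉ s.erase m := fun h => hys (mem_of_mem_erase h)
  have hfY : s.erase m ⊆ Y := (erase_subset _ _).trans hs'.1
  have hyY : y ∈ Y := htop'.1 hy
  have hmY : m ∈ Y := hs'.1 hm
  have h1 := hP _ hfY hfc hf m hmY hmf y hyY hyf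
  have h2 := hP _ hfY hfc hf y hyY hyf m hmY hmf
  rw [insert_erase hm] at h1 h2
  have hnew : ¬ (P (insert y (s.erase m)) ↔ P top) := by tauto
  have h3 := hsmax (insert y (s.erase m)) (mem_filter.2 ⟨mem_powersetCard.2
    ⟨insert_subset hyY hfY, by rw [card_insert_of_notMem hyf, hfc]⟩, hup y hys hmy, hnew⟩)
  conv_rhs at h3 => rw [← insert_erase hm]
  rw [image_insert, image_insert, Colex.insert_le_insert (rank_notMem_image hr hyf)
    (rank_notMem_image hr hmf)] at h3
  omega

/-! ### Shifting -/

section Shift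
variable {i j : Fin n}

theorem compress_singleton_of (a : Finset (Fin n)) (h : i ∈ a ∨ j ∉ a) :
    UV.compress {i} {j} a = a := by
  rw [UV.compress, if_neg]
  simp only [disjoint_singleton_left, singleton_subset_iff]
  tauto

theorem compress_singleton {t : Finset (Fin n)} (hij : i ≠ j) (hi : i ∉ t) (hj : j ∉ t) :
    UV.compress {i} {j} (insert j t) = insert i t := by
  rw [UV.compress, if_pos (by simp [hij, hi])]
  ext x
  simp only [sup_eq_union, mem_sdiff, mem_union, mem_insert, mem_singleton]
  constructor
  · tauto
  · rintro (rfl | h)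
    · exact ⟨Or.inr rfl, hij⟩
    · exact ⟨Or.inl (Or.inr h), by rintro rfl; exact hj h⟩

theorem compress_singleton_cases (hij : i ≠ j) (b : Finset (Fin n)) :
    UV.compress {i} {j} b = b ∨ ∃ t, i ∉ t ∧ j ∉ t ∧ b = insert j t ∧
      UV.compress {i} {j} b = insert i t := by
  by_cases h : i ∈ b ∨ j ∉ b
  · exact Or.inl (compress_singleton_of b h)
  · rw [not_or, not_not] at h
    have h1 : i ∉ b.erase j := fun h' => h.1 (mem_of_mem_erase h')
    refine Or.inr ⟨b.erase j, h1, notMem_erase _ _, (insert_erase h.2).symm, ?_⟩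
    conv_lhs => rw [← insert_erase h.2]
    exact compress_singleton hij h1 (notMem_erase _ _)

theorem mem_shift_of_iff (hij : i ≠ j) {a : Finset (Fin n)} (h : i ∈ a ↔ j ∈ a) :
    a ∈ UV.compression {i} {j} S ↔ a ∈ S := by
  rw [UV.mem_compression, compress_singleton_of a (by tauto)]
  constructor
  · rintro (h1 | ⟨h1, b, hb, e⟩)
    · exact h1.1
    · rcases compress_singleton_cases hij b with h2 | ⟨t, hi, hj, rfl, h2⟩
      · rwa [← e, h2]
      · rw [e] at h2
        subst h2
        have := h.1 (mem_insert_self _ _)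
        rw [mem_insert] at this
        rcases this with rfl | this
        · exact absurd rfl hij
        · exact absurd this hj
  · exact fun h => Or.inl ⟨h, h⟩

theorem insert_right_mem_shift (hij : i ≠ j) {t : Finset (Fin n)} (hi : i ∉ t) (hj : j ∉ t) :
    insert j t ∈ UV.compression {i} {j} S ↔ insert j t ∈ S ∧ insert i t ∈ S := by
  rw [UV.mem_compression, compress_singleton hij hi hj, or_iff_left]
  rintro ⟨h1, b, hb, e⟩
  rcases compress_singleton_cases hij b with h2 | ⟨u, -, -, rfl, h2⟩
  · rw [← e, h2] at h1; exact h1 hb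
  · rw [e] at h2
    have : i ∈ insert j t := by rw [h2]; exact mem_insert_self _ _
    simp [hij, hi] at this

theorem insert_left_mem_shift (hij : i ≠ j) {t : Finset (Fin n)} (hi : i ∉ t) (hj : j ∉ t) :
    insert i t ∈ UV.compression {i} {j} S ↔ insert i t ∈ S ∨ insert j t ∈ S := by
  rw [UV.mem_compression, compress_singleton_of _ (Or.inl (mem_insert_self _ _))]
  constructor
  · rintro (h1 | ⟨h1, b, hb, e⟩)
    · exact Or.inl h1.1
    · rcases compress_singleton_cases hij b with h2 | ⟨u, hiu, -, rfl, h2⟩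
      · rw [← e, h2]; exact Or.inl hb
      · rw [e] at h2
        rw [insert_injOn i hi hiu h2]
        exact Or.inr hb
  · rintro h
    by_cases h1 : insert i t ∈ S
    · exact Or.inl ⟨h1, h1⟩
    · exact Or.inr ⟨h1, _, h.resolve_left h1, compress_singleton hij hi hj⟩

/-- The measure that decreases under shifts towards smaller elements. -/
def weight (S : Finset (Finset (Fin n))) : ℕ := ∑ s ∈ S, ∑ x ∈ s, (x : ℕ)

theorem weight_shift_lt (hij : i < j) (h : UV.compression {i} {j} S ≠ S) :
    weight (UV.compression {i} {j} S) < weight S := by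
  have uA : S.filter (fun a => UV.compress {i} {j} a ∈ S) ∪
      S.filter (fun a => UV.compress {i} {j} a ∉ S) = S := filter_union_filter_not_eq _ _
  rw [UV.compression] at h ⊢
  have hne : (S.filter fun a => UV.compress {i} {j} a ∉ S).Nonempty := by
    contrapose! h
    rw [filter_image, h, image_empty, union_empty]
    rwa [h, union_empty] at uA
  rw [weight, weight, sum_union UV.compress_disjoint]
  conv_rhs => rw [← uA]
  rw [sum_union (disjoint_filter_filter_not _ _ _), add_lt_add_iff_left, filter_image,
    sum_image UV.compress_injOn]
  refine sum_lt_sum_of_nonempty hne fun a ha => ?_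
  rw [mem_filter] at ha
  rcases compress_singleton_cases hij.ne a with h1 | ⟨t, hi, hj, rfl, h1⟩
  · rw [h1] at ha; exact absurd ha.1 ha.2
  · rw [h1, sum_insert hi, sum_insert hj]
    have : (i : ℕ) < j := hij
    omega

theorem card_shadow_shift_le : (∂ (UV.compression {i} {j} S)).card ≤ (∂ S).card :=
  UV.card_shadow_compression_le _ _ (by simp [UV.isCompressed_self])

/-- If a shift does not reduce the number of sets in the shadow, it commutes with taking shadows. -/
theorem shadow_shift (h : (∂ S).card ≤ (∂ (UV.compression {i} {j} S)).card) :
    ∂ (UV.compression {i} {j} S) = UV.compression {i} {j} (∂ S) :=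
  eq_of_subset_of_card_le
    (UV.shadow_compression_subset_compression_shadow _ _ (by simp [UV.isCompressed_self]))
    (by rwa [UV.card_compression])

end Shift

end

/-! ### Uniqueness of extremal families with a short decomposition -/

section
variable {n k : ℕ} {S : Finset (Finset (Fin n))}

/-- The structure of an extremal family containing the clique that its size calls for. -/
theorem clique_or_cone {A : Finset (Fin n)} (hS : (S : Set (Finset (Fin n))).Sized (k + 2))
    (hext : (∂ S).card = kk (k + 2) S.card) (hne : S.Nonempty)
    (hA : powersetCard (k + 2) A ⊆ S) (hAc : A.card = lead (k + 2) S.card) :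
    (S = powersetCard (k + 2) A ∨ ∃ v ∉ A, ∃ T ⊆ powersetCard (k + 1) A, T.Nonempty ∧
      (∂ T).card = kk (k + 1) T.card ∧ S = cone (k + 2) A v T ∧
      len (k + 2) S.card = 1 + len (k + 1) T.card) ∧ k + 2 ≤ A.card := by
  obtain ⟨a, x, ha, hx, hm⟩ := exists_cascade (k := k + 1) hne.card_pos.ne'
  rw [hm, lead_add hx] at hAc
  subst hAc
  refine ⟨?_, ha⟩
  rcases eq_cone_of_clique hS hext hA
    (by rw [hm, Nat.choose_succ_succ' _ (k + 1)]; omega) ha with h | ⟨v, hv, T, hT, hTne, hTe, rfl⟩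
  · exact Or.inl h
  · refine Or.inr ⟨v, hv, T, hT, hTne, hTe, rfl, ?_⟩
    rw [card_cone hv hT] at hm ⊢
    obtain rfl : T.card = x := by omega
    rw [len_cascade ha hx]

/-- The link of a vertex outside of the clique is empty or the base of the cone. -/
theorem link_of_clique {A : Finset (Fin n)} (hS : (S : Set (Finset (Fin n))).Sized (k + 2))
    (hext : (∂ S).card = kk (k + 2) S.card) (hlen : len (k + 2) S.card ≤ k + 1) (hne : S.Nonempty)
    (hA : powersetCard (k + 2) A ⊆ S) (hAc : A.card = lead (k + 2) S.card) {j : Fin n}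
    (hj : j ∉ A) : (∂ (S.memberSubfamily j)).card = kk (k + 1) (S.memberSubfamily j).card ∧
      len (k + 1) (S.memberSubfamily j).card ≤ k := by
  have hempty : ∀ T : Finset (Finset (Fin n)), (∀ t ∈ T, j ∉ t) → T.memberSubfamily j = ∅ := by
    intro T hT
    rw [eq_empty_iff_forall_notMem]
    intro s hs
    rw [mem_memberSubfamily] at hs
    exact hT _ hs.1 (mem_insert_self _ _)
  rcases (clique_or_cone hS hext hne hA hAc).1 with h | ⟨v, hv, T, hT, hTne, hTe, h, hl⟩
  · have : S.memberSubfamily j = ∅ := hempty S fun t ht hjt => by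
      rw [h] at ht
      exact hj ((mem_powersetCard.1 ht).1 hjt)
    simp [this]
  · by_cases hjv : j = v
    · subst hjv
      have : S.memberSubfamily j = T := by
        ext t
        rw [mem_memberSubfamily, h]
        constructor
        · rintro ⟨h1, h2⟩
          exact (insert_mem_cone hv hT h2).1 h1
        · intro ht
          have h2 : j ∉ t := fun h => hv ((mem_powersetCard.1 (hT ht)).1 h)
          exact ⟨(insert_mem_cone hv hT h2).2 ht, h2⟩
      rw [this]
      exact ⟨hTe, by omega⟩
    · have : S.memberSubfamily j = ∅ := hempty S fun t ht hjt => by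
        rw [h] at ht
        rcases mem_union.1 ht with ht | ht
        · exact hj ((mem_powersetCard.1 ht).1 hjt)
        · obtain ⟨u, hu, rfl⟩ := mem_image.1 ht
          rcases mem_insert.1 hjt with h3 | h3
          · exact hjv h3
          · exact hj ((mem_powersetCard.1 (hT hu)).1 h3)
      simp [this]

/-- If a shift of `S` that keeps the size of the shadow contains a clique, so does `S`. The sets in
which the two families differ are connected via facets whose images under the shift do not both
lie in the shadow, so that either all of them are moved or none is. -/
theorem exists_clique_of_shift {i j : Fin n} (hij : i ≠ j)
    (hsh : (∂ S).card ≤ (∂ (UV.compression {i} {j} S)).card) {A : Finset (Fin n)}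
    (hA : powersetCard (k + 2) A ⊆ UV.compression {i} {j} S)
    (hJ : i ∈ A → j ∉ A → ∃ r : Fin n → ℕ, Function.Injective r ∧
      IsRankSeg r (k + 1) ((UV.compression {i} {j} S).memberSubfamily j) ∧
      ∀ s : Finset (Fin n), s.card = k + 1 →
        (∀ x ∈ s, s.erase x ∈ ∂ ((UV.compression {i} {j} S).memberSubfamily j)) →
        s ∈ (UV.compression {i} {j} S).memberSubfamily j) :
    ∃ B : Finset (Fin n), B.card = A.card ∧ powersetCard (k + 2) B ⊆ S := by
  set T := UV.compression {i} {j} S with hT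
  have hTm : ∀ s, i ∉ s → j ∉ s → (s ∈ T ↔ s ∈ S) := fun s h1 h2 =>
    mem_shift_of_iff hij (by tauto)
  have hdec : ∀ (x : Fin n) (s : Finset (Fin n)), x ∈ s → ∃ t, x ∉ t ∧ insert x t = s :=
    fun x s h => ⟨s.erase x, notMem_erase _ _, insert_erase h⟩
  by_cases hiA : i ∈ A
  · by_cases hjA : j ∈ A
    · refine ⟨A, rfl, fun s hs => ?_⟩
      have hsA := mem_powersetCard.1 hs
      by_cases h : i ∈ s ↔ j ∈ s
      · exact (mem_shift_of_iff hij h).1 (hA hs)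
      have key : ∀ t, i ∉ t → j ∉ t → t ⊆ A → t.card = k + 1 → insert i t ∈ S ∧ insert j t ∈ S := by
        intro t hi hj ht hc
        have := (insert_right_mem_shift hij hi hj).1 (hA (mem_powersetCard.2
          ⟨insert_subset hjA ht, by rw [card_insert_of_notMem hj, hc]⟩))
        exact this.symm
      by_cases hi : i ∈ s
      · obtain ⟨t, ht, rfl⟩ := hdec i s hi
        rw [card_insert_of_notMem ht] at hsA
        have hjt : j ∉ t := fun hj => h (by simp [hj])
        exact (key t ht hjt ((subset_insert _ _).trans hsA.1) (by omega)).1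
      · have hj : j ∈ s := by tauto
        obtain ⟨t, ht, rfl⟩ := hdec j s hj
        rw [card_insert_of_notMem ht] at hsA
        exact (key t (fun h => hi (mem_insert_of_mem h)) ht
          ((subset_insert _ _).trans hsA.1) (by omega)).2
    · obtain ⟨r, hr, hJr, hfill⟩ := hJ hiA hjA
      set J := T.memberSubfamily j with hJdef
      have hYi : ∀ s ⊆ A.erase i, i ∉ s := fun s hs h => notMem_erase _ _ (hs h)
      have hYj : ∀ s ⊆ A.erase i, j ∉ s := fun s hs h => hjA (mem_of_mem_erase (hs h))
      have hboth : ∀ s ⊆ A.erase i, s ∈ J → insert i s ∈ S ∧ insert j s ∈ S := by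
        intro s hs hsJ
        rw [hJdef, mem_memberSubfamily, hT, insert_right_mem_shift hij (hYi s hs) (hYj s hs)] at hsJ
        exact hsJ.1.symm
      have hone : ∀ s ⊆ A.erase i, s.card = k + 1 → insert i s ∈ S ∨ insert j s ∈ S := by
        intro s hs hc
        refine (insert_left_mem_shift hij (hYi s hs) (hYj s hs)).1 (hA (mem_powersetCard.2
          ⟨insert_subset hiA (hs.trans (erase_subset _ _)), ?_⟩))
        rw [card_insert_of_notMem (hYi s hs), hc]
      have hconn := @connected_compl n k r hr J hJr hfill (A.erase i) (fun s => insert i s ∈ S) (by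
        intro f hf hfc hfJ x hx hxf y hy hyf hPx
        by_contra hPy
        have hyY : insert y f ⊆ A.erase i := insert_subset hy hf
        have h1 := (hone (insert y f) hyY (by rw [card_insert_of_notMem hyf, hfc])).resolve_left hPy
        have hi := hYi f hf
        have hj := hYj f hf
        have hix : x ≠ i := ne_of_mem_erase hx
        have hjy : y ≠ j := by rintro rfl; exact hjA (mem_of_mem_erase hy)
        have h2 : insert i f ∈ ∂ S := mem_shadow_iff_insert_mem.2
          ⟨x, by simp [hxf, hix], by rwa [Finset.insert_comm]⟩
        have h3 : insert j f ∈ ∂ S := mem_shadow_iff_insert_mem.2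
          ⟨y, by simp [hyf, hjy], by rwa [Finset.insert_comm]⟩
        have h4 : insert j f ∈ ∂ T := by
          rw [hT, shadow_shift hsh]
          exact (insert_right_mem_shift hij hi hj).2 ⟨h3, h2⟩
        apply hfJ
        rw [hJdef, ← memberSubfamily_shadow, mem_memberSubfamily]
        exact ⟨h4, hj⟩)
      by_cases hall : ∀ s ∈ powersetCard (k + 1) (A.erase i), s ∉ J → insert i s ∈ S
      · refine ⟨A, rfl, fun t ht => ?_⟩
        have htA := mem_powersetCard.1 ht
        by_cases hit : i ∈ t
        · obtain ⟨s, hs, rfl⟩ := hdec i t hit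
          rw [card_insert_of_notMem hs] at htA
          have hsY : s ⊆ A.erase i := fun x hx => mem_erase.2
            ⟨by rintro rfl; exact hs hx, htA.1 (mem_insert_of_mem hx)⟩
          by_cases hsJ : s ∈ J
          · exact (hboth s hsY hsJ).1
          · exact hall s (mem_powersetCard.2 ⟨hsY, by omega⟩) hsJ
        · exact (hTm t hit (fun h => hjA (htA.1 h))).1 (hA ht)
      · push Not at hall
        obtain ⟨s₀, hs₀, hs₀J, hs₀S⟩ := hall
        have hjY : j ∉ A.erase i := fun h => hjA (mem_of_mem_erase h)
        refine ⟨insert j (A.erase i), ?_, fun t ht => ?_⟩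
        · rw [card_insert_of_notMem hjY, card_erase_of_mem hiA]
          have := card_pos.2 ⟨i, hiA⟩
          omega
        have htA := mem_powersetCard.1 ht
        by_cases hjt : j ∈ t
        · obtain ⟨s, hs, rfl⟩ := hdec j t hjt
          rw [card_insert_of_notMem hs] at htA
          have hsY : s ⊆ A.erase i := fun x hx =>
            (mem_insert.1 (htA.1 (mem_insert_of_mem hx))).resolve_left
              (by rintro rfl; exact hs hx)
          by_cases hsJ : s ∈ J
          · exact (hboth s hsY hsJ).2
          · refine (hone s hsY (by omega)).resolve_left fun h => hs₀S ?_
            exact hconn (mem_powersetCard.2 ⟨hsY, by omega⟩) hs₀ hsJ hs₀J h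
        · have hsY : t ⊆ A.erase i := fun x hx =>
            (mem_insert.1 (htA.1 hx)).resolve_left (by rintro rfl; exact hjt hx)
          exact (hTm t (hYi t hsY) hjt).1
            (hA (mem_powersetCard.2 ⟨hsY.trans (erase_subset _ _), htA.2⟩))
  · refine ⟨A, rfl, fun s hs => ?_⟩
    have hsA := mem_powersetCard.1 hs
    have his : i ∉ s := fun h => hiA (hsA.1 h)
    by_cases hj : j ∈ s
    · obtain ⟨t, ht, rfl⟩ := hdec j s hj
      exact ((insert_right_mem_shift hij (fun h => his (mem_insert_of_mem h)) ht).1 (hA hs)).1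
    · exact (hTm s his hj).1 (hA hs)

/-- Extremal families with a short decomposition contain a clique: undo the shifts that lead to a
shifted family. -/
theorem exists_clique {S : Finset (Finset (Fin n))}
    (hkey : ∀ J : Finset (Finset (Fin n)), (J : Set (Finset (Fin n))).Sized (k + 1) →
      (∂ J).card = kk (k + 1) J.card → len (k + 1) J.card ≤ k → IsColexSegment (k + 1) J)
    (hS : (S : Set (Finset (Fin n))).Sized (k + 2))
    (hext : (∂ S).card = kk (k + 2) S.card) (hlen : len (k + 2) S.card ≤ k + 1)
    (hne : S.Nonempty) :
    ∃ A : Finset (Fin n), A.card = lead (k + 2) S.card ∧ powersetCard (k + 2) A ⊆ S := by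
  by_cases hstable : ∀ i j : Fin n, i < j → UV.compression {i} {j} S = S
  · refine exists_clique_of_shifted univ S (fun _ _ => subset_univ _) hS hne ?_ hlen ?_
    · intro i _ j _ hij s hs hj hi
      rw [← hstable i j hij] at hs
      have hi' : i ∉ s.erase j := fun h => hi (mem_of_mem_erase h)
      rw [← insert_erase hj, insert_right_mem_shift hij.ne hi' (notMem_erase _ _)] at hs
      exact hs.2
    · have := kk_succ (k := k + 2) (m := S.card) (by simp)
      simp only [show k + 1 + 1 = k + 2 from rfl]
      omega
  · push Not at hstable
    obtain ⟨i, j, hij, hne'⟩ := hstable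
    have hw := weight_shift_lt hij hne'
    have hTs : (UV.compression {i} {j} S : Set (Finset (Fin n))).Sized (k + 2) :=
      hS.uvCompression (by simp)
    have hTc : (UV.compression {i} {j} S).card = S.card := UV.card_compression _ _ _
    have h1 := kk_le_card_shadow hTs
    have h2 := card_shadow_shift_le (S := S) (i := i) (j := j)
    rw [hTc] at h1
    have hTe : (∂ (UV.compression {i} {j} S)).card =
        kk (k + 2) (UV.compression {i} {j} S).card := by rw [hTc]; omega
    have hTl : len (k + 2) (UV.compression {i} {j} S).card ≤ k + 1 := by rwa [hTc]
    have hTne : (UV.compression {i} {j} S).Nonempty := card_pos.1 (by rw [hTc]; exact hne.card_pos)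
    obtain ⟨A, hAc, hA⟩ := exists_clique hkey hTs hTe hTl hTne
    rw [← hTc, ← hAc]
    refine exists_clique_of_shift hij.ne (by omega) hA fun _ hj => ?_
    obtain ⟨hJe, hJl⟩ := link_of_clique hTs hTe hTl hTne hA hAc hj
    have hJs := sized_memberSubfamily (v := j) hTs
    obtain ⟨r, hr, hJr⟩ := isColexSegment_iff.1 (hkey _ hJs hJe hJl)
    exact ⟨r, hr, hJr, fun s hs h => mem_of_facets_mem_shadow hJs hJe hJl hs h⟩
termination_by weight S

theorem isColexSegment_empty : IsColexSegment k (∅ : Finset (Finset (Fin n))) :=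
  ⟨1, by simp⟩

/-- Extremal families whose decomposition is not of full length are colex segments. -/
theorem isColexSegment_of_len_le : ∀ {k : ℕ} {S : Finset (Finset (Fin n))},
    (S : Set (Finset (Fin n))).Sized (k + 1) → (∂ S).card = kk (k + 1) S.card →
    len (k + 1) S.card ≤ k → IsColexSegment (k + 1) S := by
  intro k
  induction k with
  | zero =>
    intro S hS hext hlen
    rcases S.eq_empty_or_nonempty with rfl | hne
    · exact isColexSegment_empty
    · have := len_pos (k := 0) hne.card_pos.ne'
      omega
  | succ k ih =>
    intro S hS hext hlen
    rcases S.eq_empty_or_nonempty with rfl | hne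
    · exact isColexSegment_empty
    obtain ⟨A, hAc, hA⟩ := exists_clique (fun J h1 h2 h3 => ih h1 h2 h3) hS hext hlen hne
    rcases (clique_or_cone hS hext hne hA hAc).1 with h | ⟨v, hv, T, hT, hTne, hTe, h, hl⟩
    · rw [h]
      exact isColexSegment_powersetCard A _
    · rw [h]
      refine isColexSegment_cone hv hT (ih (fun t ht => (mem_powersetCard.1 (hT ht)).2) hTe ?_)
      simp only [show k + 1 + 1 = k + 2 from rfl] at hlen
      omega

end

/-! ### Binomial decompositions -/

section Decomp
variable {k m l c : ℕ}

theorem IsBinomialDecomp.tail {a : Fin (l + 1) → ℕ} (h : IsBinomialDecomp (k + 1) m (l + 1) a) :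
    ∃ x, m = (a 0).choose (k + 1) + x ∧ IsBinomialDecomp k x l (fun i => a i.succ) := by
  refine ⟨∑ i : Fin l, (a i.succ).choose (k - i), ?_, by have := h.length_le; omega,
    fun i j hij => h.strictAnti (Fin.succ_lt_succ_iff.2 hij), fun i => ?_, rfl⟩
  · rw [h.sum_eq, Fin.sum_univ_succ]
    simp
  · have := h.le_coeff i.succ
    simp only [Fin.val_succ] at this
    omega

/-- A decomposition with coefficients below `b` has a value below `b.choose k`, so that the greedy choice
recovers its first coefficient. -/
theorem IsBinomialDecomp.lt_choose : ∀ {k m l : ℕ} {a : Fin l → ℕ}, IsBinomialDecomp k m l a →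
    ∀ b, k ≤ b → (∀ i, a i < b) → m < b.choose k := by
  intro k
  induction k with
  | zero =>
    intro m l a h b _ _
    obtain rfl : l = 0 := by have := h.length_le; omega
    rw [h.sum_eq]
    simp
  | succ k ih =>
    intro m l a h b hb hab
    cases l with
    | zero => rw [h.sum_eq]; simpa using Nat.choose_pos hb
    | succ l =>
      obtain ⟨x, rfl, hx⟩ := h.tail
      have h0 := h.le_coeff 0
      simp only [Fin.val_zero, Nat.sub_zero] at h0
      have h1 := ih hx (a 0) (by omega) (fun i => h.strictAnti (Fin.succ_pos i))
      have h2 := Nat.choose_le_choose (k + 1) (show a 0 + 1 ≤ b from hab 0)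
      rw [Nat.choose_succ_succ'] at h2
      omega

theorem IsBinomialDecomp.len_eq_and_kk_eq : ∀ {k m l : ℕ} {a : Fin l → ℕ},
    IsBinomialDecomp k m l a →
      len k m = l ∧ kk k m = ∑ i : Fin l, (a i).choose (k - (i : ℕ) - 1) := by
  intro k
  induction k with
  | zero =>
    intro m l a h
    obtain rfl : l = 0 := by have := h.length_le; omega
    rw [h.sum_eq]
    simp
  | succ k ih =>
    intro m l a h
    cases l with
    | zero => rw [h.sum_eq]; simp
    | succ l =>
      obtain ⟨x, rfl, hx⟩ := h.tail
      have h0 := h.le_coeff 0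
      simp only [Fin.val_zero, Nat.sub_zero] at h0
      have h1 := hx.lt_choose (a 0) (by omega) (fun i => h.strictAnti (Fin.succ_pos i))
      obtain ⟨h2, h3⟩ := ih hx
      rw [len_cascade h0 h1, kk_cascade h0 h1, h2, h3, Fin.sum_univ_succ]
      refine ⟨by omega, ?_⟩
      simp

/-- The bound on the coefficients carries the induction: it makes the coefficients decrease. -/
theorem exists_isBinomialDecomp (h : k = 0 → m = 0) : ∃ (l : ℕ) (a : Fin l → ℕ),
    IsBinomialDecomp k m l a ∧ ∀ b, m < b.choose k → ∀ i, a i < b := by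
  refine cascade_induction (P := fun k m => ∃ (l : ℕ) (a : Fin l → ℕ),
    IsBinomialDecomp k m l a ∧ ∀ b, m < b.choose k → ∀ i, a i < b) ?_ ?_ k m h
  · exact fun k => ⟨0, Fin.elim0, ⟨by omega, fun i => i.elim0, fun i => i.elim0, by simp⟩,
      fun _ _ i => i.elim0⟩
  · rintro k a x ha hx ⟨l, a', h1, h2⟩
    refine ⟨l + 1, Fin.cons a a', ⟨by have := h1.length_le; omega, ?_, ?_, ?_⟩, ?_⟩
    · intro i j hij
      cases j using Fin.cases with
      | zero => simp at hij
      | succ j =>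
        cases i using Fin.cases with
        | zero => simpa using h2 a hx j
        | succ i => simpa using h1.strictAnti (Fin.succ_lt_succ_iff.1 hij)
    · intro i
      cases i using Fin.cases with
      | zero => simpa using ha
      | succ i => have := h1.le_coeff i; simp only [Fin.val_succ, Fin.cons_succ]; omega
    · rw [Fin.sum_univ_succ]
      simp [← h1.sum_eq]
    · intro b hb i
      have hab : a < b := by
        by_contra! hab
        have := Nat.choose_le_choose (k + 1) hab
        omega
      cases i using Fin.cases with
      | zero => simpa using hab
      | succ i => exact (by simpa using h2 a hx i : _ < a).trans hab

theorem hasLastCoeff_iff : HasLastCoeff (k + 1) m c ↔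
    ∃ a : Fin (k + 1) → ℕ, IsBinomialDecomp (k + 1) m (k + 1) a ∧ a (Fin.last k) = c := by
  constructor
  · rintro ⟨a, h, i, hi, rfl⟩
    obtain rfl : i = Fin.last k := Fin.ext (by simpa using hi)
    exact ⟨a, h, rfl⟩
  · rintro ⟨a, h, rfl⟩
    exact ⟨a, h, Fin.last k, by simp, rfl⟩

theorem HasLastCoeff.len_eq (h : HasLastCoeff k m c) : len k m = k := by
  obtain ⟨a, h, -⟩ := h
  exact h.len_eq_and_kk_eq.1

theorem exists_hasLastCoeff (h : len (k + 1) m = k + 1) : ∃ c, HasLastCoeff (k + 1) m c := by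
  obtain ⟨l, a, ha, -⟩ := exists_isBinomialDecomp (k := k + 1) (m := m) (by simp)
  obtain rfl : l = k + 1 := ha.len_eq_and_kk_eq.1.symm.trans h
  exact ⟨_, hasLastCoeff_iff.2 ⟨a, ha, rfl⟩⟩

theorem HasLastCoeff.one_le (h : HasLastCoeff (k + 1) m c) : 1 ≤ c := by
  obtain ⟨a, ha, rfl⟩ := hasLastCoeff_iff.1 h
  simpa using ha.le_coeff (Fin.last k)

theorem HasLastCoeff.le (h : HasLastCoeff (k + 1) m c) : c ≤ m := by
  obtain ⟨a, ha, rfl⟩ := hasLastCoeff_iff.1 h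
  rw [ha.sum_eq, Fin.sum_univ_castSucc]
  simp

theorem HasLastCoeff.pred (h : HasLastCoeff (k + 1) (m + 1) (c + 2)) :
    HasLastCoeff (k + 1) m (c + 1) := by
  obtain ⟨a, h, ha⟩ := hasLastCoeff_iff.1 h
  have hne : ∀ i : Fin k, i.castSucc ≠ Fin.last k := fun i => (Fin.castSucc_lt_last i).ne
  refine hasLastCoeff_iff.2 ⟨Function.update a (Fin.last k) (c + 1),
    ⟨le_rfl, ?_, ?_, ?_⟩, by simp⟩
  · intro i j hij
    cases i using Fin.lastCases with
    | last => exact absurd hij (Fin.le_last j).not_gt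
    | cast i =>
      have h1 := h.strictAnti hij
      cases j using Fin.lastCases with
      | last => rw [Function.update_self, Function.update_of_ne (hne i)]; omega
      | cast j => rwa [Function.update_of_ne (hne i), Function.update_of_ne (hne j)]
  · intro i
    cases i using Fin.lastCases with
    | last => simp
    | cast i => rw [Function.update_of_ne (hne i)]; exact h.le_coeff _
  · have h1 := h.sum_eq
    rw [Fin.sum_univ_castSucc, ha] at h1
    rw [Fin.sum_univ_castSucc, Function.update_self]
    simp only [Function.update_of_ne (hne _)]
    simp only [Fin.val_last, Nat.add_sub_cancel_left, Nat.choose_one_right] at h1 ⊢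
    omega

theorem HasLastCoeff.len_pred (h : HasLastCoeff (k + 1) (m + 1) 1) : len (k + 1) m = k := by
  obtain ⟨a, h, ha⟩ := hasLastCoeff_iff.1 h
  have h2 : IsBinomialDecomp (k + 1) m k (fun i => a i.castSucc) := by
    refine ⟨by omega, fun i j hij => h.strictAnti (Fin.castSucc_lt_castSucc_iff.2 hij),
      fun i => h.le_coeff i.castSucc, ?_⟩
    have h1 := h.sum_eq
    rw [Fin.sum_univ_castSucc, ha] at h1
    simp only [Fin.val_last, Nat.add_sub_cancel_left, Nat.choose_one_right,
      Fin.val_castSucc] at h1 ⊢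
    omega
  exact h2.len_eq_and_kk_eq.1

/-- Removing the last term `c = (a_{k-1}).choose 1` from the decomposition. -/
theorem HasLastCoeff.len_sub : ∀ {c m : ℕ}, HasLastCoeff (k + 1) m c →
    len (k + 1) (m - c) = k ∧ kk (k + 1) m = kk (k + 1) (m - c) + 1 := by
  intro c
  induction c with
  | zero => intro m h; exact absurd h.one_le (by omega)
  | succ c ih =>
    intro m h
    obtain ⟨m, rfl⟩ : ∃ m', m = m' + 1 := ⟨m - 1, by have := h.le; omega⟩
    have h0 := kk_succ (k := k + 1) (m := m) (by simp)
    cases c with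
    | zero =>
      have h1 := h.len_pred
      simp only [Nat.zero_add, Nat.add_sub_cancel]
      omega
    | succ c =>
      have h1 := h.pred
      have h2 := h1.len_eq
      obtain ⟨h3, h4⟩ := ih h1
      have : m + 1 - (c + 1 + 1) = m - (c + 1) := by omega
      rw [this]
      omega

end Decomp

/-! ### Extremal families -/

section
variable {n k : ℕ} {S : Finset (Finset (Fin n))} {s : Finset (Fin n)}

theorem isExtremal_iff (hk : 1 ≤ k) : IsExtremal k S ↔
    (S : Set (Finset (Fin n))).Sized k ∧ (∂ S).card = kk k S.card := by
  rw [IsExtremal, subset_powersetCard_univ_iff]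
  refine and_congr_right fun hS => ⟨?_, fun h => ?_⟩
  · rintro ⟨l, a, h, e⟩
    rw [e, h.len_eq_and_kk_eq.2]
  · obtain ⟨l, a, ha, -⟩ := exists_isBinomialDecomp (k := k) (m := S.card) (by omega)
    exact ⟨l, a, ha, by rw [h, ha.len_eq_and_kk_eq.2]⟩

theorem IsColexSegment.sized (h : IsColexSegment k S) : (S : Set (Finset (Fin n))).Sized k := by
  obtain ⟨r, -, h⟩ := isColexSegment_iff.1 h
  exact h.1

theorem IsColexSegment.card_shadow (h : IsColexSegment k S) : (∂ S).card = kk k S.card := by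
  obtain ⟨r, hr, h⟩ := isColexSegment_iff.1 h
  exact h.card_shadow hr

/-- Two consecutive extremal families, the smaller of which has a decomposition that is not of full
length, are colex segments. -/
theorem isColexSegment_insert : ∀ {k : ℕ} {S : Finset (Finset (Fin n))} {s : Finset (Fin n)},
    (((insert s S : Finset (Finset (Fin n)))) : Set (Finset (Fin n))).Sized (k + 1) → s ∉ S →
    (∂ S).card = kk (k + 1) S.card →
    (∂ (insert s S)).card = kk (k + 1) (insert s S).card → len (k + 1) S.card ≤ k →
    IsColexSegment (k + 1) (insert s S) := by
  intro k
  have hsing : ∀ (k : ℕ) (s : Finset (Fin n)), s.card = k →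
      IsColexSegment k (insert s (∅ : Finset (Finset (Fin n)))) := by
    rintro k s rfl
    have := isColexSegment_powersetCard s s.card
    rwa [powersetCard_self] at this
  induction k with
  | zero =>
    intro S s hS hs h1 h2 hlen
    rcases S.eq_empty_or_nonempty with rfl | hne
    · exact hsing _ _ (hS (mem_coe.2 (mem_insert_self _ _)))
    · have := len_pos (k := 0) hne.card_pos.ne'
      omega
  | succ k ih =>
    intro S s hS hs h1 h2 hlen
    rcases S.eq_empty_or_nonempty with rfl | hne
    · exact hsing _ _ (hS (mem_coe.2 (mem_insert_self _ _)))
    have hS' : (S : Set (Finset (Fin n))).Sized (k + 2) := hS.mono (by simp)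
    obtain ⟨A, hAc, hA⟩ := exists_clique (fun J h1 h2 h3 => isColexSegment_of_len_le h1 h2 h3)
      hS' h1 hlen hne
    obtain ⟨a, x, ha, hx, hm⟩ := exists_cascade (k := k + 1) hne.card_pos.ne'
    rw [hm, lead_add hx] at hAc
    subst hAc
    have hcard : (insert s S).card ≤ (A.card + 1).choose (k + 2) := by
      rw [card_insert_of_notMem hs, hm, Nat.choose_succ_succ' _ (k + 1)]
      omega
    rcases eq_cone_of_clique hS h2 (hA.trans (subset_insert _ _)) hcard ha with
      h | ⟨v, hv, T, hT, hTne, hTe, h⟩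
    · rw [h]; exact isColexSegment_powersetCard _ _
    have hTs : (T : Set (Finset (Fin n))).Sized (k + 1) := fun t ht =>
      (mem_powersetCard.1 (hT ht)).2
    have hvT : ∀ t ∈ T, v ∉ t := fun t ht hvt => hv ((mem_powersetCard.1 (hT ht)).1 hvt)
    obtain ⟨t, ht, hts⟩ : ∃ t ∈ T, insert v t = s := by
      have : s ∈ cone (k + 2) A v T := by rw [← h]; exact mem_insert_self _ _
      rcases mem_union.1 this with h3 | h3
      · exact absurd (hA h3) hs
      · simpa using h3
    have hTe' : T.erase t ⊆ powersetCard (k + 1) A := (erase_subset _ _).trans hT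
    have hSe : S = cone (k + 2) A v (T.erase t) := by
      rw [← erase_insert hs, h]
      ext u
      by_cases hvu : v ∈ u
      · obtain ⟨w, hw, rfl⟩ : ∃ w, v ∉ w ∧ insert v w = u :=
          ⟨u.erase v, notMem_erase _ _, insert_erase hvu⟩
        rw [insert_mem_cone hv hTe' hw, mem_erase, mem_erase, insert_mem_cone hv hT hw, ← hts]
        refine and_congr_left fun _ => not_congr ⟨fun e => insert_injOn v hw (hvT t ht) e, ?_⟩
        rintro rfl; rfl
      · rw [mem_erase, mem_cone_of_notMem hvu, mem_cone_of_notMem hvu, and_iff_right]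
        rintro rfl
        exact hvu (by rw [← hts]; exact mem_insert_self _ _)
    have h3 := card_cone hv hTe'
    have h4 := card_shadow_cone hv hTe' (Or.inl ha)
    rw [← hSe] at h3 h4
    obtain rfl : (T.erase t).card = x := by
      simp only [show k + 1 + 1 = k + 2 from rfl] at hm h3
      omega
    rw [hm, len_cascade ha hx] at hlen
    rw [hm, kk_cascade ha hx] at h1
    rw [h]
    refine isColexSegment_cone hv hT ?_
    rw [← insert_erase ht]
    refine ih (by rwa [insert_erase ht]) (notMem_erase _ _) (by omega) ?_ (by omega)
    rwa [insert_erase ht]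

end

section
variable {n k : ℕ} {S : Finset (Finset (Fin n))} {s e : Finset (Fin n)}

theorem IsExtremal.sized (h : IsExtremal k S) : (S : Set (Finset (Fin n))).Sized k :=
  subset_powersetCard_univ_iff.1 h.1

theorem IsExtremal.card_shadow (hk : 1 ≤ k) (h : IsExtremal k S) : (∂ S).card = kk k S.card :=
  ((isExtremal_iff hk).1 h).2

theorem IsColexSegment.isExtremal (hk : 1 ≤ k) (h : IsColexSegment k S) : IsExtremal k S :=
  (isExtremal_iff hk).2 ⟨h.sized, h.card_shadow⟩

theorem IsExtremal.isColexSegment (hk : 1 ≤ k) (h : IsExtremal k S) (hlen : len k S.card < k) :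
    IsColexSegment k S := by
  obtain ⟨k, rfl⟩ : ∃ l, k = l + 1 := ⟨k - 1, by omega⟩
  exact isColexSegment_of_len_le h.sized (h.card_shadow hk) (by omega)

theorem isExtremal_of_card_shadow_le (hk : 1 ≤ k) (hS : (S : Set (Finset (Fin n))).Sized k)
    (h : (∂ S).card ≤ kk k S.card) : IsExtremal k S :=
  (isExtremal_iff hk).2 ⟨hS, le_antisymm h (kk_le_card_shadow hS)⟩

theorem sized_insert (hS : (S : Set (Finset (Fin n))).Sized k) (hs : s.card = k) :
    ((insert s S : Finset (Finset (Fin n))) : Set (Finset (Fin n))).Sized k := by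
  intro t ht
  rcases mem_insert.1 (mem_coe.1 ht) with rfl | ht
  · exact hs
  · exact hS ht

theorem IsColexSegment.exists_insert (h : IsColexSegment k S) (hS : S ≠ powersetCard k univ) :
    ∃ s, s.card = k ∧ s ∉ S ∧ IsColexSegment k (insert s S) := by
  obtain ⟨r, hr, h⟩ := isColexSegment_iff.1 h
  obtain ⟨s, hs, hsS, hs'⟩ := h.exists_insert hr hS
  exact ⟨s, by simpa using hs, hsS, isColexSegment_iff.2 ⟨r, hr, hs'⟩⟩

theorem IsColexSegment.exists_erase (h : IsColexSegment k S) (hS : S.Nonempty) :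
    ∃ s ∈ S, IsColexSegment k (S.erase s) := by
  obtain ⟨r, hr, h⟩ := isColexSegment_iff.1 h
  obtain ⟨s, hs, hs'⟩ := h.exists_erase hr hS
  exact ⟨s, hs, isColexSegment_iff.2 ⟨r, hr, hs'⟩⟩

/-! ### Adding and removing one set -/

theorem shadow_insert_of_facets (h : ∀ x ∈ s, s.erase x ∈ ∂ S) : ∂ (insert s S) = ∂ S := by
  refine subset_antisymm (fun f hf => ?_) (shadow_mono (subset_insert _ _))
  obtain ⟨t, ht, a, ha, rfl⟩ := mem_shadow_iff.1 hf
  rcases mem_insert.1 ht with rfl | ht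
  · exact h a ha
  · exact erase_mem_shadow ht ha

theorem isExtremal_insert_of_facets (hk : 1 ≤ k) (hS : IsExtremal k S) (hs : s.card = k)
    (h : ∀ x ∈ s, s.erase x ∈ ∂ S) : IsExtremal k (insert s S) := by
  refine isExtremal_of_card_shadow_le hk (sized_insert hS.sized hs) ?_
  rw [shadow_insert_of_facets h, hS.card_shadow hk]
  exact kk_mono k (card_le_card (subset_insert _ _))

/-- The facets of `s` outside of the shadow of `S` are new in the shadow of `insert s S`. -/
theorem card_shadow_add_le {U : Finset (Fin n)} (hU : U ⊆ s) (h : ∀ x ∈ U, s.erase x ∉ ∂ S) :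
    (∂ S).card + U.card ≤ (∂ (insert s S)).card := by
  have hinj : Set.InjOn s.erase U := (erase_injOn s).mono (by simpa using hU)
  rw [← card_image_of_injOn hinj, ← card_union_of_disjoint]
  · refine card_le_card (union_subset (shadow_mono (subset_insert _ _)) fun f hf => ?_)
    obtain ⟨x, hx, rfl⟩ := mem_image.1 hf
    exact erase_mem_shadow (mem_insert_self _ _) (hU hx)
  · rw [disjoint_right]
    intro f hf
    obtain ⟨x, hx, rfl⟩ := mem_image.1 hf
    exact h x hx

/-- The bound grows by `k - len k #S` only, which limits the number of new facets. -/
theorem card_add_len_le (hk : 1 ≤ k) (hS : IsExtremal k S) (hsS : s ∉ S)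
    (hins : IsExtremal k (insert s S)) {U : Finset (Fin n)} (hU : U ⊆ s)
    (h : ∀ x ∈ U, s.erase x ∉ ∂ S) : U.card + len k S.card ≤ k := by
  have h1 := card_shadow_add_le hU h
  have h2 := hins.card_shadow hk
  rw [card_insert_of_notMem hsS] at h2
  have h3 := kk_succ (k := k) (m := S.card) (by omega)
  have h4 := hS.card_shadow hk
  omega

/-- If adding `s` keeps extremality but enlarges the shadow, both families are segments. -/
theorem isColexSegment_of_insert (hk : 1 ≤ k) (hS : IsExtremal k S) (hsS : s ∉ S)
    (hins : IsExtremal k (insert s S)) (h : ¬ ∀ x ∈ s, s.erase x ∈ ∂ S) :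
    len k S.card < k ∧ IsColexSegment k S ∧ IsColexSegment k (insert s S) := by
  push Not at h
  obtain ⟨x, hx, hxS⟩ := h
  have h1 := card_add_len_le hk hS hsS hins (U := {x}) (by simpa using hx) (by simpa using hxS)
  rw [card_singleton] at h1
  refine ⟨by omega, hS.isColexSegment hk (by omega), ?_⟩
  obtain ⟨k, rfl⟩ : ∃ l, k = l + 1 := ⟨k - 1, by omega⟩
  exact isColexSegment_insert hins.sized hsS (hS.card_shadow hk) (hins.card_shadow hk) (by omega)

/-! ### The hypergraph of minimal missing sets -/

theorem mem_iterate_shadow_iff (hS : (S : Set (Finset (Fin n))).Sized k) (he : e.card ≤ k) :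
    e ∈ ∂^[k - e.card] S ↔ ∃ t ∈ S, e ⊆ t := by
  rw [mem_shadow_iterate_iff_exists_mem_card_add]
  refine exists_congr fun t => and_congr_right fun ht => and_iff_left ?_
  have := hS ht
  omega

theorem isMissing_iff (hS : (S : Set (Finset (Fin n))).Sized k) :
    IsMissing k S e ↔ 1 ≤ e.card ∧ e.card ≤ k ∧ ∀ t ∈ S, ¬ e ⊆ t := by
  rw [IsMissing]
  refine and_congr_right fun _ => and_congr_right fun h => ?_
  rw [mem_iterate_shadow_iff hS h]
  push Not
  rfl

theorem exists_hyperedge_subset (h : IsMissing k S s) : ∃ e ∈ hyperedges k S, e ⊆ s := by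
  obtain ⟨e, hes, he⟩ := exists_minimal_le_of_wellFoundedLT (IsMissing k S) s h
  exact ⟨e, he, hes⟩

theorem isMissing_of_notMem (hk : 1 ≤ k) (hs : s.card = k) (hsS : s ∉ S) : IsMissing k S s := by
  refine ⟨by omega, by omega, ?_⟩
  rw [hs, Nat.sub_self]
  exact hsS

/-- Every proper subset of an edge is contained in a member of the family. -/
theorem exists_mem_of_ssubset_hyperedge (hS : (S : Set (Finset (Fin n))).Sized k)
    (hne : S.Nonempty) (he : e ∈ hyperedges k S) {f : Finset (Fin n)} (hf : f ⊂ e) :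
    ∃ t ∈ S, f ⊆ t := by
  by_contra! h
  have he' := (isMissing_iff hS).1 he.prop
  have hfe := card_lt_card hf
  obtain ⟨t, ht⟩ := hne
  have hf0 : f.Nonempty := by
    rw [nonempty_iff_ne_empty]
    rintro rfl
    exact h t ht (empty_subset _)
  exact hf.2 (he.le_of_le ((isMissing_iff hS).2 ⟨hf0.card_pos, by omega, h⟩) hf.1)

theorem facets_mem_shadow_of_hyperedge (hS : (S : Set (Finset (Fin n))).Sized k)
    (hne : S.Nonempty) (he : e ∈ hyperedges k S) (hek : e.card = k) :
    ∀ x ∈ e, e.erase x ∈ ∂ S := by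
  intro x hx
  obtain ⟨t, ht, h⟩ := exists_mem_of_ssubset_hyperedge hS hne he (erase_ssubset hx)
  refine mem_shadow_iff_exists_mem_card_add_one.2 ⟨t, ht, h, ?_⟩
  rw [card_erase_add_one hx, hek, hS ht]

theorem hyperedge_of_facets (hk : 1 ≤ k) (hS : (S : Set (Finset (Fin n))).Sized k)
    (hs : s.card = k) (hsS : s ∉ S) (h : ∀ x ∈ s, s.erase x ∈ ∂ S) : s ∈ hyperedges k S := by
  refine ⟨isMissing_of_notMem hk hs hsS, fun e he hes => ?_⟩
  by_contra hse
  obtain ⟨x, hx, hxe⟩ := not_subset.1 hse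
  obtain ⟨t, ht, hst⟩ := exists_subset_of_mem_shadow (h x hx)
  exact ((isMissing_iff hS).1 he).2.2 t ht
    (fun y hy => hst (mem_erase.2 ⟨by rintro rfl; exact hxe hy, hes hy⟩))

theorem erase_notMem_shadow_of_missing (hS : (S : Set (Finset (Fin n))).Sized k)
    (he : IsMissing k S e) (hes : e ⊆ s) {x : Fin n} (hx : x ∉ e) : s.erase x ∉ ∂ S := by
  intro h
  obtain ⟨t, ht, hst⟩ := exists_subset_of_mem_shadow h
  exact ((isMissing_iff hS).1 he).2.2 t ht
    (fun y hy => hst (mem_erase.2 ⟨by rintro rfl; exact hx hy, hes hy⟩))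

/-- Iterated shadows keep the length of the decomposition as long as the uniformity permits. -/
theorem IsColexSegment.iterate_shadow (h : IsColexSegment k S) :
    ∀ d, len k S.card + d ≤ k → IsColexSegment (k - d) (∂^[d] S) ∧
      len (k - d) (∂^[d] S).card = len k S.card := by
  intro d
  induction d with
  | zero => intro _; exact ⟨h, rfl⟩
  | succ d ih =>
    intro hd
    obtain ⟨h1, h2⟩ := ih (by omega)
    obtain ⟨j, hj⟩ : ∃ j, k - d = j + 1 := ⟨k - d - 1, by omega⟩
    have hj' : k - (d + 1) = j := by omega
    rw [Function.iterate_succ_apply', hj']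
    rw [hj] at h1 h2
    refine ⟨h1.shadow, ?_⟩
    rw [h1.card_shadow, len_kk (by omega), h2]

/-- The edges of a colex segment have at most as many elements as its decomposition has terms. -/
theorem IsColexSegment.card_hyperedge_le (h : IsColexSegment k S) (hne : S.Nonempty)
    (he : e ∈ hyperedges k S) : e.card ≤ len k S.card := by
  by_contra! hlt
  obtain ⟨he1, hek, hmiss⟩ := (isMissing_iff h.sized).1 he.prop
  obtain ⟨h1, h2⟩ := h.iterate_shadow (k - e.card) (by omega)
  obtain ⟨j, hj⟩ : ∃ j, e.card = j + 1 := ⟨e.card - 1, by omega⟩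
  rw [show k - (k - e.card) = j + 1 by omega] at h1 h2
  have hmem : e ∈ ∂^[k - e.card] S := by
    refine mem_of_facets_mem_shadow h1.sized h1.card_shadow (by omega) hj fun x hx => ?_
    obtain ⟨t, ht, hxt⟩ := exists_mem_of_ssubset_hyperedge h.sized hne he (erase_ssubset hx)
    rw [← Function.iterate_succ_apply' Finset.shadow, mem_shadow_iterate_iff_exists_mem_card_add]
    refine ⟨t, ht, hxt, ?_⟩
    rw [card_erase_of_mem hx, h.sized ht]
    omega
  exact he.prop.2.2 hmem

theorem isMissing_shadow_iff :
    IsMissing (k - 1) (∂ S) e ↔ IsMissing k S e ∧ e.card ≤ k - 1 := by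
  have key : 1 ≤ e.card → e.card ≤ k - 1 → ∂^[k - 1 - e.card] (∂ S) = ∂^[k - e.card] S := by
    intro h1 h2
    rw [← Function.iterate_succ_apply]
    congr 1
    omega
  unfold IsMissing
  constructor
  · rintro ⟨h1, h2, h3⟩
    rw [key h1 h2] at h3
    exact ⟨⟨h1, by omega, h3⟩, h2⟩
  · rintro ⟨⟨h1, _, h3⟩, h2⟩
    exact ⟨h1, h2, by rwa [key h1 h2]⟩

theorem hyperedges_shadow :
    hyperedges (k - 1) (∂ S) = {f ∈ hyperedges k S | f.card ≤ k - 1} := by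
  ext e
  constructor
  · intro he
    have h1 := isMissing_shadow_iff.1 he.prop
    refine ⟨⟨h1.1, fun f hf hfe => ?_⟩, h1.2⟩
    exact he.le_of_le (isMissing_shadow_iff.2 ⟨hf, (card_le_card hfe).trans h1.2⟩) hfe
  · rintro ⟨he, hc⟩
    refine ⟨isMissing_shadow_iff.2 ⟨he.prop, hc⟩, fun f hf hfe => ?_⟩
    exact he.le_of_le (isMissing_shadow_iff.1 hf).1 hfe

/-- A family of nonempty sets is determined by its hypergraph. -/
theorem subset_of_hyperedges_eq {T : Finset (Finset (Fin n))} (hk : 1 ≤ k)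
    (hS : (S : Set (Finset (Fin n))).Sized k)
    (h : hyperedges k S = hyperedges k T) : S ⊆ T := by
  intro s hs
  by_contra hsT
  obtain ⟨e, he, hes⟩ := exists_hyperedge_subset (isMissing_of_notMem hk (hS hs) hsT)
  rw [← h] at he
  exact ((isMissing_iff hS).1 he.prop).2.2 s hs hes

end

/-! ### Maximal and minimal families -/

section
variable {n k : ℕ} {S : Finset (Finset (Fin n))} {s e : Finset (Fin n)}

/-- The facets `s \ {x}` with `x ∉ e` are new, so that `k - #e ≤ k - len k #S`; as edges have at most
`len k #S` elements, `e` is as large as possible. A second edge `f ⊆ s` would give more new facets. -/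
theorem insert_isExtremal_iff_of_hyperedge (hk : 1 ≤ k) (hS : IsExtremal k S)
    (hs : s ∈ powersetCard k (support S)) (hsS : s ∉ S) (he : e ∈ hyperedges k S) (hes : e ⊆ s)
    (hek : e.card < k) : IsExtremal k (insert s S) ↔
      (IsColexSegment k S ∧ IsColexSegment k (insert s S)) ∧
      ((∀ f ∈ hyperedges k S, f.card ≤ e.card) ∧ ∀ f ∈ hyperedges k S, f.card ≠ k) ∧
      (∀ f ∈ hyperedges k S, f ⊆ s → f = e) := by
  refine ⟨fun hins => ?_, fun h => h.1.2.isExtremal hk⟩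
  obtain ⟨hsP, hsk⟩ := mem_powersetCard.1 hs
  have hne : S.Nonempty := by
    obtain ⟨x, hx⟩ := card_pos.1 (by omega : 0 < s.card)
    obtain ⟨t, ht, -⟩ := mem_biUnion.1 (hsP hx)
    exact ⟨t, ht⟩
  obtain ⟨x, hxs, hxe⟩ := exists_mem_notMem_of_card_lt_card (s := e) (t := s) (by omega)
  obtain ⟨hlen, hcol, hcol'⟩ := isColexSegment_of_insert hk hS hsS hins fun h =>
    erase_notMem_shadow_of_missing hS.sized he.prop hes hxe (h x hxs)
  have hle : ∀ f ∈ hyperedges k S, f.card ≤ len k S.card := fun f hf =>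
    hcol.card_hyperedge_le hne hf
  have hge : len k S.card ≤ e.card := by
    have := card_add_len_le hk hS hsS hins (U := s \ e) sdiff_subset fun x hx =>
      erase_notMem_shadow_of_missing hS.sized he.prop hes (mem_sdiff.1 hx).2
    rw [card_sdiff_of_subset hes] at this
    omega
  refine ⟨⟨hcol, hcol'⟩, ⟨fun f hf => (hle f hf).trans hge, fun f hf => ?_⟩, fun f hf hfs => ?_⟩
  · have := hle f hf
    omega
  · have h1 := card_add_len_le hk hS hsS hins (U := s \ (e ∩ f)) sdiff_subset fun x hx => by
      rw [mem_sdiff, mem_inter, not_and_or] at hx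
      rcases hx.2 with h | h
      · exact erase_notMem_shadow_of_missing hS.sized he.prop hes h
      · exact erase_notMem_shadow_of_missing hS.sized hf.prop hfs h
    have h2 : e ∩ f ⊆ s := inter_subset_left.trans hes
    rw [card_sdiff_of_subset h2] at h1
    have h3 := card_le_card h2
    have h4 := hle e he
    have h5 : e ∩ f = e := eq_of_subset_of_card_le inter_subset_left (by omega)
    have h6 : e ⊆ f := by rw [← h5]; exact inter_subset_right
    exact subset_antisymm (hf.le_of_le he.prop h6) h6

theorem forall_not_isExtremal_insert_iff (hk : 1 ≤ k) (hS : IsExtremal k S)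
    (hfull : S ≠ powersetCard k univ) :
    (∀ s ∈ powersetCard k univ, s ∉ S → ¬ IsExtremal k (insert s S)) ↔
      (∀ f ∈ hyperedges k S, f.card ≠ k) ∧ ¬ IsColexSegment k S := by
  constructor
  · intro h
    have hcol : ¬ IsColexSegment k S := fun hcol => by
      obtain ⟨s, hs, hsS, hins⟩ := hcol.exists_insert hfull
      exact h s (by simpa using hs) hsS (hins.isExtremal hk)
    refine ⟨fun f hf hfk => ?_, hcol⟩
    have hne : S.Nonempty := by
      rw [nonempty_iff_ne_empty]
      rintro rfl
      exact hcol isColexSegment_empty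
    refine h f (by simpa using hfk) (fun hfS => ?_) (isExtremal_insert_of_facets hk hS hfk
      (facets_mem_shadow_of_hyperedge hS.sized hne hf hfk))
    exact ((isMissing_iff hS.sized).1 hf.prop).2.2 f hfS subset_rfl
  · rintro ⟨h1, h2⟩ s hs hsS hins
    have hsk : s.card = k := by simpa using hs
    by_cases h : ∀ x ∈ s, s.erase x ∈ ∂ S
    · exact h1 s (hyperedge_of_facets hk hS.sized hsk hsS h) hsk
    · exact h2 (isColexSegment_of_insert hk hS hsS hins h).2.1

/-- If the last coefficient of the decomposition of `#S` is at least two, then some set can be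
removed without reducing the shadow: otherwise every set has a private facet, and removing as many
sets as the last coefficient says leaves too small a shadow. -/
theorem exists_isExtremal_erase {c : ℕ} (hk : 1 ≤ k) (hS : IsExtremal k S)
    (hc : HasLastCoeff k S.card c) (hc2 : 2 ≤ c) : ∃ s ∈ S, IsExtremal k (S.erase s) := by
  obtain ⟨k, rfl⟩ : ∃ l, k = l + 1 := ⟨k - 1, by omega⟩
  by_contra! hno
  obtain ⟨c, rfl⟩ : ∃ d, c = d + 2 := ⟨c - 2, by omega⟩
  have hcm := hc.le
  obtain ⟨m, hm⟩ : ∃ m, S.card = m + 1 := ⟨S.card - 1, by omega⟩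
  have hkk : kk (k + 1) m = kk (k + 1) S.card := by
    have h1 := kk_succ (k := k + 1) (m := m) (by simp)
    rw [hm] at hc ⊢
    have := hc.pred.len_eq
    omega
  have hpriv : ∀ s ∈ S, ∃ f ∈ ∂ S, f ∉ ∂ (S.erase s) := by
    intro s hs
    by_contra! h
    refine hno s hs (isExtremal_of_card_shadow_le hk (hS.sized.mono (by simp)) ?_)
    rw [card_erase_of_mem hs, hm, Nat.add_sub_cancel, hkk, ← hS.card_shadow hk]
    exact card_le_card (shadow_mono (erase_subset _ _))
  choose! p hp hp' using hpriv
  obtain ⟨U, hU, hUc⟩ := exists_subset_card_eq hcm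
  have hkeep : ∀ s ∈ S, ∀ t ∈ S, t ≠ s → p s ≠ p t := by
    intro s hs t ht hts e
    -- The private facet of `s` is a facet of some member, which can only be `s` and only be `t`.
    obtain ⟨u, hu, a, ha, hua⟩ := mem_shadow_iff.1 (hp s hs)
    by_cases hus : u = s
    · refine hp' t ht ?_
      rw [← e, ← hua]
      exact erase_mem_shadow (mem_erase.2 ⟨by rw [hus]; exact hts.symm, hu⟩) ha
    · refine hp' s hs ?_
      rw [← hua]
      exact erase_mem_shadow (mem_erase.2 ⟨hus, hu⟩) ha
  have hinj : Set.InjOn p U := fun s hs t ht e => by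
    by_contra hne
    exact hkeep s (hU hs) t (hU ht) (Ne.symm hne) e
  have hsub : ∂ (S \ U) ∪ U.image p ⊆ ∂ S := by
    refine union_subset (shadow_mono sdiff_subset) fun f hf => ?_
    obtain ⟨s, hs, rfl⟩ := mem_image.1 hf
    exact hp s (hU hs)
  have hdisj : Disjoint (∂ (S \ U)) (U.image p) := by
    rw [disjoint_right]
    intro f hf hf'
    obtain ⟨s, hs, rfl⟩ := mem_image.1 hf
    refine hp' s (hU hs) (shadow_mono (fun t ht => ?_) hf')
    rw [mem_sdiff] at ht
    exact mem_erase.2 ⟨by rintro rfl; exact ht.2 hs, ht.1⟩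
  have h1 := card_le_card hsub
  rw [card_union_of_disjoint hdisj, card_image_of_injOn hinj, hUc, hS.card_shadow hk] at h1
  have h2 : ((S \ U : Finset (Finset (Fin n))) : Set (Finset (Fin n))).Sized (k + 1) :=
    hS.sized.mono (by simp)
  have h3 := kk_le_card_shadow h2
  rw [card_sdiff_of_subset hU, hUc] at h3
  have h4 := hc.len_sub.2
  omega

theorem forall_not_isExtremal_erase_iff (hk : 1 ≤ k) (hS : IsExtremal k S) (hne : S.Nonempty) :
    (∀ s ∈ S, ¬ IsExtremal k (S.erase s)) ↔
      HasLastCoeff k S.card 1 ∧ ¬ ∃ s ∈ S, IsColexSegment k (S.erase s) := by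
  constructor
  · intro h
    have hcol : ¬ ∃ s ∈ S, IsColexSegment k (S.erase s) := fun ⟨s, hs, hcol⟩ =>
      h s hs (hcol.isExtremal hk)
    refine ⟨?_, hcol⟩
    have hlen : len k S.card = k := by
      by_contra hlen
      exact hcol ((hS.isColexSegment hk (lt_of_le_of_ne (len_le _ _) hlen)).exists_erase hne)
    obtain ⟨k, rfl⟩ : ∃ l, k = l + 1 := ⟨k - 1, by omega⟩
    obtain ⟨c, hc⟩ := exists_hasLastCoeff hlen
    have hc1 := hc.one_le
    rcases hc1.eq_or_lt with rfl | hc2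
    · exact hc
    · obtain ⟨s, hs, hs'⟩ := exists_isExtremal_erase hk hS hc hc2
      exact absurd hs' (h s hs)
  · rintro ⟨hc, hno⟩ s hs hext
    refine hno ⟨s, hs, hext.isColexSegment hk ?_⟩
    obtain ⟨k, rfl⟩ : ∃ l, k = l + 1 := ⟨k - 1, by omega⟩
    rw [card_erase_of_mem hs, hc.len_sub.1]
    omega

/-! ### Chains -/

theorem hasAddingChain_full : HasAddingChain k (powersetCard k (univ : Finset (Fin n))) :=
  ⟨[], by simp, by simp, fun i h1 h2 => absurd (h1.trans h2) (by simp)⟩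

theorem HasAddingChain.cons (hs : s.card = k) (hsS : s ∉ S) (hins : IsExtremal k (insert s S))
    (h : HasAddingChain k (insert s S)) : HasAddingChain k S := by
  obtain ⟨L, hL, hLS, hext⟩ := h
  refine ⟨s :: L, ?_, ?_, ?_⟩
  · refine List.nodup_cons.2 ⟨fun hsL => ?_, hL⟩
    have : s ∈ L.toFinset := by simpa using hsL
    rw [hLS] at this
    simp at this
  · rw [List.toFinset_cons, hLS]
    ext t
    simp only [mem_insert, mem_sdiff, mem_powersetCard, subset_univ, true_and]
    by_cases e : t = s
    · subst e; simp [hs, hsS]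
    · simp [e]
  · intro i hi hi'
    obtain ⟨i, rfl⟩ : ∃ j, i = j + 1 := ⟨i - 1, by omega⟩
    rw [List.take_succ_cons, List.toFinset_cons, union_insert, ← insert_union]
    rcases Nat.eq_zero_or_pos i with rfl | hpos
    · simpa using hins
    · exact hext i hpos (by simpa using hi')

theorem HasAddingChain.exists_insert (h : HasAddingChain k S) (hS : S ⊆ powersetCard k univ)
    (hfull : S ≠ powersetCard k univ) : ∃ s, s.card = k ∧ s ∉ S ∧ IsExtremal k (insert s S) ∧
      HasAddingChain k (insert s S) := by
  obtain ⟨L, hL, hLS, hext⟩ := h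
  cases L with
  | nil =>
    rw [List.toFinset_nil, eq_comm, sdiff_eq_empty_iff_subset] at hLS
    exact absurd (subset_antisymm hS hLS) hfull
  | cons s L =>
    have hsL : s ∈ powersetCard k univ \ S := by rw [← hLS]; simp
    rw [mem_sdiff] at hsL
    refine ⟨s, by simpa using hsL.1, hsL.2, ?_, L, (List.nodup_cons.1 hL).2, ?_, ?_⟩
    · have := hext 1 le_rfl (by simp)
      simpa using this
    · rw [List.toFinset_cons] at hLS
      have hs' : s ∉ L.toFinset := by simpa using (List.nodup_cons.1 hL).1
      rw [← erase_insert hs', hLS]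
      ext t
      simp only [mem_insert, mem_sdiff, mem_erase]
      tauto
    · intro i hi hi'
      have := hext (i + 1) (by omega) (by simpa using hi')
      rwa [List.take_succ_cons, List.toFinset_cons, union_insert, ← insert_union] at this

/-- As long as the added sets have all facets in the shadow, the shadow does not change; the first one
that has not reveals a segment. -/
theorem shadow_isColexSegment_of_hasAddingChain (hk : 1 ≤ k) {S : Finset (Finset (Fin n))}
    (hS : IsExtremal k S) (h : HasAddingChain k S) : IsColexSegment (k - 1) (∂ S) := by
  by_cases hfull : S = powersetCard k univ
  · rw [hfull]
    exact (isColexSegment_powersetCard univ k).shadow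
  obtain ⟨s, hsk, hsS, hins, h'⟩ := h.exists_insert hS.1 hfull
  by_cases hf : ∀ x ∈ s, s.erase x ∈ ∂ S
  · rw [← shadow_insert_of_facets hf]
    exact shadow_isColexSegment_of_hasAddingChain hk hins h'
  · exact (isColexSegment_of_insert hk hS hsS hins hf).2.1.shadow
termination_by (powersetCard k univ \ S).card
decreasing_by
  refine card_lt_card ⟨sdiff_subset_sdiff subset_rfl (subset_insert _ _), fun hh => ?_⟩
  have := hh (mem_sdiff.2 ⟨by simpa using hsk, hsS⟩)
  simp at this

/-- If all `k`-sets with all facets in a segment are taken, the result is a segment. -/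
theorem isColexSegment_of_shadow (hk : 1 ≤ k) (hS : (S : Set (Finset (Fin n))).Sized k)
    (hsh : IsColexSegment (k - 1) (∂ S))
    (h : ∀ s : Finset (Fin n), s.card = k → (∀ x ∈ s, s.erase x ∈ ∂ S) → s ∈ S) :
    IsColexSegment k S := by
  obtain ⟨r, hr, hsh⟩ := isColexSegment_iff.1 hsh
  refine isColexSegment_iff.2 ⟨r, hr, hS, fun s hs t ht hts => h t ht fun x hx => ?_⟩
  have hsk := hS hs
  obtain ⟨m, hm, hmin⟩ := exists_min_image s r (card_pos.1 (by omega))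
  refine hsh.2 _ (erase_mem_shadow hs hm) _ (by rw [card_erase_of_mem hx, ht]) ?_
  have h1 := erase_le_erase_min' hts
    (by rw [card_image_of_injective _ hr, card_image_of_injective _ hr, ht, hsk])
    (mem_image_of_mem r hx)
  rw [image_erase hr, image_erase hr]
  convert h1
  refine le_antisymm (le_min' _ _ _ fun y hy => ?_) (min'_le _ _ (mem_image_of_mem r hm))
  obtain ⟨z, hz, rfl⟩ := mem_image.1 hy
  exact hmin z hz

/-- Sets that do not enlarge the shadow are added first; when there are none left, the family is a
segment, and the next sets of the order are added. -/
theorem hasAddingChain_of_shadow (hk : 1 ≤ k) {S : Finset (Finset (Fin n))} (hS : IsExtremal k S)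
    (hsh : IsColexSegment (k - 1) (∂ S)) : HasAddingChain k S := by
  by_cases hfull : S = powersetCard k univ
  · rw [hfull]
    exact hasAddingChain_full
  obtain ⟨s, hsk, hsS, hins, hsh'⟩ : ∃ s, s.card = k ∧ s ∉ S ∧ IsExtremal k (insert s S) ∧
      IsColexSegment (k - 1) (∂ (insert s S)) := by
    by_cases h : ∃ s : Finset (Fin n), s.card = k ∧ (∀ x ∈ s, s.erase x ∈ ∂ S) ∧ s ∉ S
    · obtain ⟨s, hsk, hf, hsS⟩ := h
      exact ⟨s, hsk, hsS, isExtremal_insert_of_facets hk hS hsk hf,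
        by rwa [shadow_insert_of_facets hf]⟩
    · push Not at h
      obtain ⟨s, hsk, hsS, hins⟩ :=
        (isColexSegment_of_shadow hk hS.sized hsh h).exists_insert hfull
      exact ⟨s, hsk, hsS, hins.isExtremal hk, hins.shadow⟩
  exact (hasAddingChain_of_shadow hk hins hsh').cons hsk hsS hins
termination_by (powersetCard k univ \ S).card
decreasing_by
  refine card_lt_card ⟨sdiff_subset_sdiff subset_rfl (subset_insert _ _), fun hh => ?_⟩
  have := hh (mem_sdiff.2 ⟨by simpa using hsk, hsS⟩)
  simp at this

theorem shadow_isColexSegment_iff (hk : 1 ≤ k) (hS : (S : Set (Finset (Fin n))).Sized k) :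
    IsColexSegment (k - 1) (∂ S) ↔ ∃ T : Finset (Finset (Fin n)), IsColexSegment (k - 1) T ∧
      hyperedges (k - 1) T = {f ∈ hyperedges k S | f.card ≤ k - 1} := by
  constructor
  · exact fun h => ⟨_, h, hyperedges_shadow⟩
  · rintro ⟨T, hT, h⟩
    rw [← hyperedges_shadow] at h
    rcases hk.eq_or_lt with rfl | hk
    · -- A family of sets of size zero is empty or complete.
      have hsub : ∂ S ⊆ {∅} := fun t ht => by
        rw [mem_singleton, ← card_eq_zero]
        exact hS.shadow ht
      rcases subset_singleton_iff.1 hsub with e | e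
      · rw [e]; exact isColexSegment_empty
      · rw [e]; simpa using isColexSegment_powersetCard (∅ : Finset (Fin n)) 0
    · have : ∂ S = T := subset_antisymm
        (subset_of_hyperedges_eq (by omega) hS.shadow h.symm)
        (subset_of_hyperedges_eq (by omega) hT.sized h)
      rwa [this]

theorem HasRemovingChain.cons (hs : s ∈ S) (hext : IsExtremal k (S.erase s))
    (h : HasRemovingChain k (S.erase s)) : HasRemovingChain k S := by
  obtain ⟨L, hL, hLS, hL'⟩ := h
  refine ⟨s :: L, ?_, ?_, ?_⟩
  · refine List.nodup_cons.2 ⟨fun hsL => ?_, hL⟩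
    have : s ∈ L.toFinset := by simpa using hsL
    rw [hLS] at this
    simp at this
  · rw [List.toFinset_cons, hLS, insert_erase hs]
  · intro i hi hi'
    obtain ⟨i, rfl⟩ : ∃ j, i = j + 1 := ⟨i - 1, by omega⟩
    rw [List.take_succ_cons, List.toFinset_cons, sdiff_insert, ← erase_sdiff_comm]
    rcases Nat.eq_zero_or_pos i with rfl | hpos
    · simpa using hext
    · exact hL' i hpos (by simpa using hi')

theorem IsColexSegment.hasRemovingChain (hk : 1 ≤ k) {S : Finset (Finset (Fin n))}
    (h : IsColexSegment k S) : HasRemovingChain k S := by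
  rcases S.eq_empty_or_nonempty with rfl | hne
  · exact ⟨[], by simp, by simp, fun i h1 h2 => absurd (h1.trans h2) (by simp)⟩
  obtain ⟨s, hs, hs'⟩ := h.exists_erase hne
  exact (hs'.hasRemovingChain hk).cons hs (hs'.isExtremal hk)
termination_by S.card
decreasing_by exact card_erase_lt_of_mem hs

/-- Removing the last `c` sets lowers the length below `k`, so that the remaining family is a segment.
Conversely, the members of `T` can be removed in any order since the bound drops only with the last
of them. -/
theorem hasRemovingChain_iff {c : ℕ} (hk : 1 ≤ k) (hS : IsExtremal k S)
    (hc : HasLastCoeff k S.card c) : HasRemovingChain k S ↔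
      1 ≤ c ∧ ∃ T ⊆ S, T.card = c ∧ IsColexSegment k (S \ T) := by
  obtain ⟨k, rfl⟩ : ∃ l, k = l + 1 := ⟨k - 1, by omega⟩
  constructor
  · rintro ⟨L, hL, hLS, hext⟩
    have hcL : c ≤ L.length := by
      rw [← List.toFinset_card_of_nodup hL, hLS]
      exact hc.le
    have hsub : (L.take c).toFinset ⊆ S := by
      rw [← hLS]
      intro t ht
      rw [List.mem_toFinset] at ht ⊢
      exact List.mem_of_mem_take ht
    have hcard : (L.take c).toFinset.card = c := by
      rw [List.toFinset_card_of_nodup (hL.sublist (List.take_sublist _ _)), List.length_take]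
      omega
    refine ⟨hc.one_le, _, hsub, hcard, (hext c hc.one_le hcL).isColexSegment hk ?_⟩
    rw [card_sdiff_of_subset hsub, hcard, hc.len_sub.1]
    omega
  · rintro ⟨-, T, hTS, hT, hcol⟩
    induction c generalizing S T with
    | zero => exact absurd hc.one_le (by omega)
    | succ c ih =>
      obtain ⟨t, ht⟩ := card_pos.1 (by omega : 0 < T.card)
      have htS := hTS ht
      have hcard := card_erase_add_one htS
      have e : S.erase t \ T.erase t = S \ T := by
        ext u
        simp only [mem_sdiff, mem_erase]
        by_cases hu : u = t
        · subst hu; simp [ht]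
        · simp [hu]
      cases c with
      | zero =>
        have : T.erase t = ∅ := by rw [← card_eq_zero, card_erase_of_mem ht, hT]
        rw [this, sdiff_empty] at e
        rw [← e] at hcol
        exact (hcol.hasRemovingChain hk).cons htS (hcol.isExtremal hk)
      | succ c =>
        rw [← hcard] at hc
        have hc' := hc.pred
        have h1 := kk_succ (k := k + 1) (m := (S.erase t).card) (by simp)
        rw [hc'.len_eq, hcard] at h1
        have hext : IsExtremal (k + 1) (S.erase t) := by
          refine isExtremal_of_card_shadow_le hk (hS.sized.mono (by simp)) ?_
          have h2 := card_le_card (shadow_mono (erase_subset t S))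
          rw [hS.card_shadow hk] at h2
          omega
        exact (ih hext hc' (T.erase t) (erase_subset_erase _ hTS)
          (by rw [card_erase_of_mem ht, hT]; rfl) (by rwa [e])).cons htS hext

end

end ExtremalFamily

theorem theoremt (n k : ℕ) (hk : 1 ≤ k) (S : Finset (Finset (Fin n))) (hS : IsExtremal k S) :
    -- adding one `k`-set `s` inside the support of `S` that contains the edge `e`
    (∀ s ∈ Finset.powersetCard k (support S), s ∉ S → ∀ e ∈ hyperedges k S, e ⊆ s →
      (e.card = k →
        (∀ f ∈ hyperedges k S, f ⊆ s → f = e) ∧ IsExtremal k (insert s S)) ∧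
      (e.card < k →
        (IsExtremal k (insert s S) ↔
          (IsColexSegment k S ∧ IsColexSegment k (insert s S)) ∧
          ((∀ f ∈ hyperedges k S, f.card ≤ e.card) ∧ ∀ f ∈ hyperedges k S, f.card ≠ k) ∧
          (∀ f ∈ hyperedges k S, f ⊆ s → f = e)))) ∧
    -- (1) maximal families
    (S ≠ Finset.powersetCard k Finset.univ →
      ((∀ s ∈ Finset.powersetCard k Finset.univ, s ∉ S → ¬ IsExtremal k (insert s S)) ↔
        (∀ f ∈ hyperedges k S, f.card ≠ k) ∧ ¬ IsColexSegment k S)) ∧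
    -- (2) minimal families
    (S.Nonempty →
      ((∀ s ∈ S, ¬ IsExtremal k (S.erase s)) ↔
        HasLastCoeff k S.card 1 ∧ ¬ ∃ s ∈ S, IsColexSegment k (S.erase s))) ∧
    -- (3) extremal chains up to the full family
    ((HasAddingChain k S ↔ IsColexSegment (k - 1) (Finset.shadow S)) ∧
      (IsColexSegment (k - 1) (Finset.shadow S) ↔
        ∃ T : Finset (Finset (Fin n)), IsColexSegment (k - 1) T ∧
          hyperedges (k - 1) T = {f ∈ hyperedges k S | f.card ≤ k - 1})) ∧
    -- (4) extremal chains down to the empty family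
    ((∀ c : ℕ, HasLastCoeff k S.card c →
        (HasRemovingChain k S ↔
          1 ≤ c ∧ ∃ T ⊆ S, T.card = c ∧ IsColexSegment k (S \ T))) ∧
      ((¬ ∃ c : ℕ, HasLastCoeff k S.card c) → HasRemovingChain k S)) := by
  refine ⟨fun s hs hsS e he hes => ⟨fun hek => ?_, fun hek =>
      insert_isExtremal_iff_of_hyperedge hk hS hs hsS he hes hek⟩,
    fun hfull => forall_not_isExtremal_insert_iff hk hS hfull,
    fun hne => forall_not_isExtremal_erase_iff hk hS hne,
    ⟨⟨shadow_isColexSegment_of_hasAddingChain hk hS, hasAddingChain_of_shadow hk hS⟩,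
      shadow_isColexSegment_iff hk hS.sized⟩,
    fun c hc => hasRemovingChain_iff hk hS hc, fun hno => ?_⟩
  · obtain ⟨hsP, hsk⟩ := Finset.mem_powersetCard.1 hs
    obtain rfl : e = s := Finset.eq_of_subset_of_card_le hes (by omega)
    refine ⟨fun f hf hfe => Finset.Subset.antisymm hfe (he.le_of_le hf.prop hfe), ?_⟩
    have hne : S.Nonempty := by
      obtain ⟨x, hx⟩ := Finset.card_pos.1 (by omega : 0 < e.card)
      obtain ⟨t, ht, -⟩ := Finset.mem_biUnion.1 (hsP hx)
      exact ⟨t, ht⟩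
    exact isExtremal_insert_of_facets hk hS hsk
      (facets_mem_shadow_of_hyperedge hS.sized hne he hek)
  · obtain ⟨k, rfl⟩ : ∃ l, k = l + 1 := ⟨k - 1, by omega⟩
    refine (hS.isColexSegment hk (lt_of_le_of_ne (len_le _ _) fun h => ?_)).hasRemovingChain hk
    exact hno (exists_hasLastCoeff h)
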